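/- Let $q$ be a prime power, let $n\ge 0$ be an integer with $n\neq 1$, and let $V$ be an $n$-dimensional vector space over the finite field $\mathbb{F}_q$. Let $\mathrm{V}$ and $\Lambda$ be the posets on three elements $x,y,z$ whose only strict relations are $z<x,\ z<y$ and $x<z,\ y<z$, respectively. Let $\mathrm{La}_q^*(n,\{\mathrm{V},\Lambda\})$ be the maximum size of a family of subspaces of $V$ (ordered by inclusion) which contains neither $\mathrm{V}$ nor $\Lambda$ as an induced subposet. Then $$\mathrm{La}_q^*(n,\{\mathrm{V},\Lambda\})=\binom{n}{\lfloor n/2\rfloor}_q,\qquad\text{where } \binom{n}{k}_q=\prod_{0\le i<k}\frac{q^{n-i}-1}{q^{k-i}-1}.$$ Moreover, if $(n,q)\neq(2,2)$, then a family of subspaces of $V$ is a family of maximum size containing neither $\mathrm{V}$ nor $\Lambda$ as an induced subposet if and only if it is one of the following: the set of all $\lfloor n/2\rfloor$-dimensional subspaces of $V$; the set of all $\lceil n/2\rceil$-dimensional subspaces of $V$; or, only when $n=3$ and $q=2$, for some basis $v_0,v_1,v_2$ of $V$, one of the two families * $\{\langle v_0,v_1\rangle,\langle v_0,v_2\rangle,\langle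 v_1,v_2\rangle\}$ together with all one-dimensional subspaces other than $\langle v_0\rangle,\langle v_1\rangle,\langle v_2\rangle$; * $\{\langle v_0\rangle,\langle v_1\rangle,\langle v_2\rangle\}$ together with all two-dimensional subspaces other than $\langle v_0,v_1\rangle,\langle v_0,v_2\rangle,\langle v_1,v_2\rangle$. -/

import Mathlib

/-- The three elements `x`, `y`, `z` underlying the poset `V`. -/
inductive VPoset : Type
  | x : VPoset
  | y : VPoset
  | z : VPoset

/-- The poset `V`: its only strict relations are `z < x` and `z < y`. -/
instance VPoset.instPartialOrder : PartialOrder VPoset where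
  le a b := a = b ∨ a = VPoset.z
  le_refl _ := Or.inl rfl
  le_trans a b c hab hbc := by
    rcases hab with rfl | rfl
    · exact hbc
    · exact Or.inr rfl
  le_antisymm a b hab hba := by
    rcases hab with rfl | rfl
    · rfl
    · rcases hba with h | h
      · exact h.symm
      · exact h.symm

/-- The poset `Λ`: the three elements `x`, `y`, `z` with the relations of `V` reversed, so that
its only strict relations are `x < z` and `y < z`. -/
abbrev LambdaPoset : Type := VPosetᵒᵈ

/-- The collection `{V, Λ}`. -/
def VLambda : Set PartOrd.{0} := {PartOrd.of VPoset, PartOrd.of LambdaPoset}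

section LinearLattice

variable (K : Type*) (V : Type*) [Field K] [AddCommGroup V] [Module K V]

/-- A family of subspaces (ordered by inclusion) contains no member of the collection `C` as an
induced subposet. -/
def IsInducedFree {K V : Type*} [Field K] [AddCommGroup V] [Module K V]
    (C : Set PartOrd) (F : Set (Submodule K V)) : Prop :=
  ∀ P ∈ C, IsEmpty (P ↪o F)

/-- The sizes of families of subspaces of `V` containing no member of `C` as an induced
subposet. -/
def inducedFreeSizes (C : Set PartOrd) : Set ℕ :=
  {m | ∃ F : Set (Submodule K V), IsInducedFree C F ∧ F.ncard = m}

/-- The maximum size of a family of subspaces of `V` containing no member of `C` as an induced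
subposet. -/
noncomputable def LaStar (C : Set PartOrd) : ℕ :=
  sSup (inducedFreeSizes K V C)

/-- For a finite space and a collection of nonempty posets, the maximum in `LaStar` is attained. -/
theorem isGreatest_LaStar [Finite V] (C : Set PartOrd) (hC : ∀ P ∈ C, Nonempty P) :
    IsGreatest (inducedFreeSizes K V C) (LaStar K V C) := by
  have hfin : Finite (Submodule K V) :=
    Finite.of_injective (fun W : Submodule K V => (W : Set V)) SetLike.coe_injective
  have hne : (inducedFreeSizes K V C).Nonempty := by
    refine ⟨0, ∅, fun P hP => ⟨fun f => ?_⟩, Set.ncard_empty _⟩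
    obtain ⟨p⟩ := hC P hP
    exact (f p).2
  have hbdd : BddAbove (inducedFreeSizes K V C) := by
    refine ⟨Nat.card (Submodule K V), ?_⟩
    rintro m ⟨F, -, rfl⟩
    rw [← Set.ncard_univ]
    exact Set.ncard_le_ncard (Set.subset_univ F) Set.finite_univ
  exact ⟨Nat.sSup_mem hne hbdd, fun m hm => le_csSup hbdd hm⟩

/-- The set of all `k`-dimensional subspaces of `V`. -/
def level (k : ℕ) : Set (Submodule K V) :=
  {W | Module.finrank K W = k}

/-- For a basis `v₀, v₁, v₂`: the three planes `⟨vᵢ, vⱼ⟩` (`i ≠ j`) together with all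
one-dimensional subspaces other than `⟨v₀⟩, ⟨v₁⟩, ⟨v₂⟩`. -/
def planesOfBasisFamily {K V : Type*} [Field K] [AddCommGroup V] [Module K V]
    (v : Module.Basis (Fin 3) K V) : Set (Submodule K V) :=
  {W | ∃ i j : Fin 3, i ≠ j ∧ W = Submodule.span K {v i, v j}} ∪
    {W | Module.finrank K W = 1 ∧ ∀ i : Fin 3, W ≠ Submodule.span K {v i}}

/-- For a basis `v₀, v₁, v₂`: the three lines `⟨vᵢ⟩` together with all two-dimensional subspaces
other than the planes `⟨vᵢ, vⱼ⟩` (`i ≠ j`). -/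
def linesOfBasisFamily {K V : Type*} [Field K] [AddCommGroup V] [Module K V]
    (v : Module.Basis (Fin 3) K V) : Set (Submodule K V) :=
  {W | ∃ i : Fin 3, W = Submodule.span K {v i}} ∪
    {W | Module.finrank K W = 2 ∧
      ∀ i j : Fin 3, i ≠ j → W ≠ Submodule.span K {v i, v j}}

end LinearLattice

/-- The Gaussian binomial coefficient, for `k ≤ n` and `2 ≤ q`. -/
def gaussBinom (q n k : ℕ) : ℚ :=
  ∏ i ∈ Finset.range k, ((q : ℚ) ^ (n - i) - 1) / ((q : ℚ) ^ (k - i) - 1)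

/-! Let M be the size of the level of dimension ⌊n/2⌋, and let F contain neither poset. Equivalently
(`isInducedFree_VLambda_iff`), two members of F lying above, or below, a common member are
comparable. If F contains ⊥ or ⊤, it is a chain with at most n + 1 members. For n ≥ 2 this is at
most M, and less than M unless n = q = 2.

Otherwise a weighted form of the LYM argument applies. Fix a full flag E and let g run over GL(V).
The event of A ∈ F is that gE passes through A and through no other member of F whose dimension lies
in the window between dim A and n - dim A. Of two dimensions, the one closer to n/2 lies in the
window of the other, so the events are disjoint (`disjoint_flagEvent`). The members of F above A
form a chain, so for dim A < n/2 it suffices that the first step of the flag after A leaves the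
largest of them in the window; the case dim A > n/2 is dual. Counting gives probability above 1/M
when dim A is at distance at least 1 from n/2, and at least 2/M at distance at least 3/2
(`lt_card_flagEvent`). For even n, middle members have probability exactly 1/M, which gives the
bound and the equality case (`even_case`).

For n = 2m + 1 the events do not settle the two middle levels. There the intervals [S, T] with dim S
= m - 1 and dim T = m + 2 are used. Each is a projective plane of order q in which F selects points
X and lines Y, every selected element being incident with at most one selected element of the other
kind. A variance computation gives |X| + |Y| ≤ q² + q + 1, with equality only for all points, all
lines, or, when q = 2, a mixed configuration of 3 + 4 elements (`IsPlane.trichotomy`). Averaging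
over the planes, with the events paying for members outside the two levels, gives the bound; in the
equality case no outside members exist and every plane attains its maximum (`odd_case`).

If no plane is mixed, connectedness of the m-dimensional subspaces forces F to be a level
(`eq_level_of_no_mixed`). A mixed plane is impossible for m ≥ 2 (`not_isMixed_between`). For m = 1
it is the whole Fano plane, and F comes from a triangle (`eq_basisFamily_of_isMixed`). -/

open Module Finset

/-! ### Transitivity of GL(V), counts in subspace intervals, sizes of levels. -/

section Counting

variable {K V : Type*} [Field K] [AddCommGroup V] [Module K V]

/-- The `q`-analogue `1 + q + ⋯ + q ^ (k - 1)` of the integer `k`. -/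
def qInt (q k : ℕ) : ℕ := ∑ i ∈ range k, q ^ i

lemma qInt_succ (q k : ℕ) : qInt q (k + 1) = q * qInt q k + 1 := by
  simp only [qInt, Finset.sum_range_succ', pow_zero, pow_succ', Finset.mul_sum]

lemma qInt_add (q a b : ℕ) : qInt q (a + b) = qInt q a + q ^ a * qInt q b := by
  simp only [qInt, Finset.sum_range_add, pow_add, Finset.mul_sum]

lemma qInt_mul_sub_one (q k : ℕ) : (qInt q k : ℚ) * (q - 1) = (q : ℚ) ^ k - 1 := by
  simp [qInt, geom_sum_mul]

lemma qInt_mono (q : ℕ) : Monotone (qInt q) := fun _ _ hab =>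
  Finset.sum_le_sum_of_subset (Finset.range_mono hab)

lemma qInt_pos (q : ℕ) {k : ℕ} (hk : 0 < k) : 0 < qInt q k := by
  obtain ⟨k, rfl⟩ := Nat.exists_eq_succ_of_ne_zero hk.ne'
  rw [Nat.succ_eq_add_one, qInt_succ]; omega

lemma Submodule.exists_map_equiv_eq [FiniteDimensional K V] {A A' : Submodule K V}
    (h : finrank K A = finrank K A') :
    ∃ g : V ≃ₗ[K] V, A.map (g : V →ₗ[K] V) = A' := by
  let e : A ≃ₗ[K] A' := LinearEquiv.ofFinrankEq _ _ h
  obtain ⟨g, hg⟩ := Submodule.exists_linearEquiv_restrict_eq e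
  refine ⟨g, Submodule.eq_of_le_of_finrank_eq ?_ ?_⟩
  · rintro _ ⟨x, hx, rfl⟩
    have := hg ⟨x, hx⟩
    simp only [LinearEquiv.coe_coe, ← this]
    exact (e ⟨x, hx⟩).2
  · rw [← h]; exact LinearEquiv.finrank_map_eq g A

/-- Carry B to B' first; then move the image of A to A' by an automorphism of B' and extend that to
V. -/
lemma Submodule.exists_map_equiv_eq_pair [FiniteDimensional K V] {A B A' B' : Submodule K V}
    (hAB : A ≤ B) (hAB' : A' ≤ B') (hA : finrank K A = finrank K A')
    (hB : finrank K B = finrank K B') :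
    ∃ g : V ≃ₗ[K] V, A.map (g : V →ₗ[K] V) = A' ∧ B.map (g : V →ₗ[K] V) = B' := by
  obtain ⟨g₁, hg₁⟩ := exists_map_equiv_eq hB
  set A₁ := A.map (g₁ : V →ₗ[K] V) with hA₁
  have hA₁B : A₁ ≤ B' := by rw [← hg₁]; exact Submodule.map_mono hAB
  have hfin : finrank K (A₁.comap B'.subtype) = finrank K (A'.comap B'.subtype) := by
    rw [(Submodule.comapSubtypeEquivOfLe hA₁B).finrank_eq,
      (Submodule.comapSubtypeEquivOfLe hAB').finrank_eq, ← hA]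
    exact LinearEquiv.finrank_map_eq g₁ A
  obtain ⟨e, he⟩ := exists_map_equiv_eq hfin
  obtain ⟨g₂, hg₂⟩ := Submodule.exists_linearEquiv_restrict_eq e
  refine ⟨g₁.trans g₂, ?_, ?_⟩
  · have h1 : A.map ((g₁.trans g₂ : V ≃ₗ[K] V) : V →ₗ[K] V) = A₁.map (g₂ : V →ₗ[K] V) := by
      rw [hA₁, ← Submodule.map_comp]; rfl
    rw [h1]
    refine Submodule.eq_of_le_of_finrank_eq ?_ ?_
    · rintro _ ⟨x, hx, rfl⟩
      have h2 := hg₂ ⟨x, hA₁B hx⟩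
      simp only [LinearEquiv.coe_coe, ← h2]
      have h3 : e ⟨x, hA₁B hx⟩ ∈ A'.comap B'.subtype := by
        rw [← he]; exact ⟨_, hx, rfl⟩
      exact h3
    · rw [← hA]
      exact (LinearEquiv.finrank_map_eq g₂ A₁).trans (LinearEquiv.finrank_map_eq g₁ A)
  · have h1 : B.map ((g₁.trans g₂ : V ≃ₗ[K] V) : V →ₗ[K] V) = B'.map (g₂ : V →ₗ[K] V) := by
      rw [← hg₁, ← Submodule.map_comp]; rfl
    rw [h1]
    refine Submodule.eq_of_le_of_finrank_eq ?_ (LinearEquiv.finrank_map_eq g₂ B')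
    rintro _ ⟨x, hx, rfl⟩
    have h2 := hg₂ ⟨x, hx⟩
    simp only [LinearEquiv.coe_coe, ← h2]
    exact (e ⟨x, hx⟩).2

lemma natCard_finrank_one [Finite K] (q n : ℕ) (hq : Nat.card K = q) (hn : finrank K V = n) :
    Nat.card {W : Submodule K V // finrank K W = 1} = qInt q n := by
  rw [← Nat.card_congr (Projectivization.equivSubmodule K V),
    Projectivization.card_of_finrank K V hn, hq, qInt]

lemma Submodule.finrank_comap_mkQ [FiniteDimensional K V] (A : Submodule K V)
    (X : Submodule K (V ⧸ A)) :
    finrank K (X.comap A.mkQ) = finrank K A + finrank K X := by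
  have h1 := LinearMap.finrank_range_add_finrank_ker (A.mkQ.comp (X.comap A.mkQ).subtype)
  have h2 : LinearMap.range (A.mkQ.comp (X.comap A.mkQ).subtype) = X := by
    rw [LinearMap.range_comp, Submodule.range_subtype,
      Submodule.map_comap_eq_of_surjective A.mkQ_surjective]
  have h3 : finrank K (LinearMap.ker (A.mkQ.comp (X.comap A.mkQ).subtype)) = finrank K A := by
    rw [LinearMap.ker_comp, Submodule.ker_mkQ]
    exact (Submodule.comapSubtypeEquivOfLe (Submodule.le_comap_mkQ A X)).finrank_eq
  rw [h2, h3] at h1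
  omega

lemma natCard_above [Finite K] [FiniteDimensional K V] (q : ℕ) (hq : Nat.card K = q)
    (A : Submodule K V) :
    Nat.card {X : Submodule K V // A ≤ X ∧ finrank K X = finrank K A + 1} =
      qInt q (finrank K V - finrank K A) := by
  have hn : finrank K (V ⧸ A) = finrank K V - finrank K A := by
    have := A.finrank_quotient_add_finrank; omega
  rw [← natCard_finrank_one q _ hq hn]
  refine (Nat.card_congr (Equiv.trans ?_ (Equiv.subtypeSubtypeEquivSubtypeInter _ _))).symm
  refine (Submodule.comapMkQRelIso A).toEquiv.subtypeEquiv fun X => ?_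
  have h : finrank K ((Submodule.comapMkQRelIso A) X : Submodule K V)
      = finrank K A + finrank K X := Submodule.finrank_comap_mkQ A X
  change _ ↔ finrank K ((Submodule.comapMkQRelIso A) X : Submodule K V) = _
  omega

lemma natCard_interval_atoms [Finite K] [FiniteDimensional K V] (q : ℕ) (hq : Nat.card K = q)
    {A B : Submodule K V} (hAB : A ≤ B) :
    Nat.card {X : Submodule K V // (A ≤ X ∧ X ≤ B) ∧ finrank K X = finrank K A + 1} =
      qInt q (finrank K B - finrank K A) := by
  have h0 := (Submodule.comapSubtypeEquivOfLe hAB).finrank_eq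
  have h1 := natCard_above q hq (A.comap B.subtype)
  rw [h0] at h1
  rw [← h1]
  refine (Nat.card_congr ?_).symm
  refine (Equiv.trans ((B.mapIic).toEquiv.subtypeEquiv (q := fun Y : Set.Iic B =>
    A ≤ Y.1 ∧ finrank K Y.1 = finrank K A + 1) fun X => ?_)
    (Equiv.subtypeSubtypeEquivSubtypeInter (fun X => X ≤ B)
      (fun X => A ≤ X ∧ finrank K X = finrank K A + 1))).trans
      (Equiv.subtypeEquivRight fun X => ?_)
  · change _ ↔ A ≤ X.map B.subtype ∧ finrank K (X.map B.subtype) = _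
    rw [Submodule.finrank_map_subtype_eq, ← h0]
    refine and_congr_left fun _ => ?_
    rw [← Submodule.map_le_map_iff_of_injective B.injective_subtype,
      Submodule.map_comap_subtype, inf_eq_right.2 hAB]
  · tauto

/-- Annihilators reverse the interval and turn coatoms into atoms of the dual interval, which has
the same length. -/
lemma natCard_interval_coatoms [Finite K] [FiniteDimensional K V] (q : ℕ) (hq : Nat.card K = q)
    {A B : Submodule K V} (hAB : A ≤ B) :
    Nat.card {X : Submodule K V // (A ≤ X ∧ X ≤ B) ∧ finrank K X + 1 = finrank K B} =
      qInt q (finrank K B - finrank K A) := by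
  have hA := Subspace.finrank_add_finrank_dualAnnihilator_eq A
  have hB := Subspace.finrank_add_finrank_dualAnnihilator_eq B
  have h := natCard_interval_atoms q hq
    (Subspace.dualAnnihilator_le_dualAnnihilator_iff.2 hAB)
  have e : finrank K B - finrank K A
      = finrank K A.dualAnnihilator - finrank K B.dualAnnihilator := by omega
  rw [e, ← h]
  refine Nat.card_congr ?_
  refine (Subspace.orderIsoFiniteDimensional (K := K) (V := V)).toEquiv.subtypeEquiv fun X => ?_
  have hX := Subspace.finrank_add_finrank_dualAnnihilator_eq X
  change _ ↔ (B.dualAnnihilator ≤ X.dualAnnihilator ∧ X.dualAnnihilator ≤ A.dualAnnihilator) ∧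
    finrank K X.dualAnnihilator = _
  rw [Subspace.dualAnnihilator_le_dualAnnihilator_iff,
    Subspace.dualAnnihilator_le_dualAnnihilator_iff, and_comm (a := X ≤ B)]
  refine and_congr_right fun _ => ?_
  omega

section Finite

open scoped Classical in
lemma card_atoms [Finite K] [FiniteDimensional K V] [Fintype (Submodule K V)] {q : ℕ}
    (hq : Nat.card K = q) {A B : Submodule K V} (hAB : A ≤ B) :
    #{X : Submodule K V | (A ≤ X ∧ X ≤ B) ∧ finrank K X = finrank K A + 1} =
      qInt q (finrank K B - finrank K A) := by
  rw [← natCard_interval_atoms q hq hAB, Nat.card_eq_fintype_card, Fintype.card_subtype]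

open scoped Classical in
lemma card_coatoms [Finite K] [FiniteDimensional K V] [Fintype (Submodule K V)] {q : ℕ}
    (hq : Nat.card K = q) {A B : Submodule K V} (hAB : A ≤ B) :
    #{X : Submodule K V | (A ≤ X ∧ X ≤ B) ∧ finrank K X + 1 = finrank K B} =
      qInt q (finrank K B - finrank K A) := by
  rw [← natCard_interval_coatoms q hq hAB, Nat.card_eq_fintype_card, Fintype.card_subtype]

open scoped Classical in
lemma ncard_level [Fintype (Submodule K V)] (k : ℕ) :
    (level K V k).ncard = #{X : Submodule K V | finrank K X = k} := by
  rw [Set.ncard_eq_toFinset_card']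
  congr 1
  ext X
  rw [Set.mem_toFinset, Finset.mem_filter_univ]
  rfl

open scoped Classical in
-- Double counting of inclusions between consecutive levels. `gaussBinom_succ` is the same
-- recursion, which identifies the two quantities.
lemma ncard_level_succ [Finite K] [FiniteDimensional K V] [Fintype (Submodule K V)] {q n : ℕ}
    (hq : Nat.card K = q) (hn : finrank K V = n) (k : ℕ) :
    (level K V (k + 1)).ncard * qInt q (k + 1) = (level K V k).ncard * qInt q (n - k) := by
  have h := Finset.sum_card_bipartiteAbove_eq_sum_card_bipartiteBelow
    (s := {X : Submodule K V | finrank K X = k}) (t := {X : Submodule K V | finrank K X = k + 1})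
    (fun A B : Submodule K V => A ≤ B)
  rw [Finset.sum_congr rfl (g := fun _ => qInt q (n - k)), Finset.sum_const, eq_comm,
    Finset.sum_congr rfl (g := fun _ => qInt q (k + 1)), Finset.sum_const] at h
  · rw [ncard_level, ncard_level]
    simpa using h
  · intro B hB
    rw [Finset.mem_filter_univ] at hB
    have := card_coatoms hq (bot_le : ⊥ ≤ B)
    rw [finrank_bot, hB, Nat.sub_zero] at this
    rw [← this, Finset.bipartiteBelow, Finset.filter_filter]
    congr 1
    ext X
    simp [and_comm]
  · intro A hA
    rw [Finset.mem_filter_univ] at hA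
    have := card_atoms hq (le_top : A ≤ ⊤)
    rw [finrank_top, hA, hn] at this
    rw [← this, Finset.bipartiteAbove, Finset.filter_filter]
    congr 1
    ext X
    simp [and_comm]

lemma level_zero [FiniteDimensional K V] : level K V 0 = {⊥} := by
  ext X
  simp [level, Submodule.finrank_eq_zero]

lemma gaussBinom_succ {q : ℕ} (hq : 2 ≤ q) (n k : ℕ) :
    gaussBinom q n (k + 1) * qInt q (k + 1) = gaussBinom q n k * qInt q (n - k) := by
  have hq1 : (q : ℚ) - 1 ≠ 0 := by
    have : (2 : ℚ) ≤ q := by exact_mod_cast hq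
    linarith
  have hk : (q : ℚ) ^ (k + 1) - 1 ≠ 0 := by
    have : (1 : ℚ) < (q : ℚ) ^ (k + 1) := one_lt_pow₀ (by exact_mod_cast hq) (by omega)
    linarith
  have h1 := qInt_mul_sub_one q (k + 1)
  have h2 := qInt_mul_sub_one q (n - k)
  have h3 : gaussBinom q n (k + 1) * ((q : ℚ) ^ (k + 1) - 1)
      = gaussBinom q n k * ((q : ℚ) ^ (n - k) - 1) := by
    simp only [gaussBinom, Finset.prod_div_distrib]
    rw [Finset.prod_range_succ, Finset.prod_range_succ' (fun i => (q : ℚ) ^ (k + 1 - i) - 1)]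
    simp only [Nat.add_sub_add_right, Nat.sub_zero]
    rw [div_mul_eq_mul_div, mul_div_mul_right _ _ hk, div_mul_eq_mul_div]
  rw [← h1, ← h2, ← mul_assoc, ← mul_assoc] at h3
  exact mul_right_cancel₀ hq1 h3

variable [Finite K] [FiniteDimensional K V] {q n : ℕ}

lemma finite_submodule (K V : Type*) [Field K] [AddCommGroup V] [Module K V] [Finite K]
    [FiniteDimensional K V] : Finite (Submodule K V) :=
  have := Module.finite_of_finite K (M := V)
  inferInstance

lemma two_le_of_natCard_eq (hq : Nat.card K = q) : 2 ≤ q := by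
  have := Finite.one_lt_card (α := K)
  omega

lemma ncard_level_eq_gaussBinom (hq : Nat.card K = q) (hn : finrank K V = n) (k : ℕ) :
    ((level K V k).ncard : ℚ) = gaussBinom q n k := by
  have := finite_submodule K V
  have := Fintype.ofFinite (Submodule K V)
  induction k with
  | zero => simp [level_zero, gaussBinom]
  | succ k ih =>
    have h1 : ((level K V (k + 1)).ncard * qInt q (k + 1) : ℚ)
        = (level K V k).ncard * qInt q (n - k) := by
      exact_mod_cast ncard_level_succ hq hn k
    rw [ih, ← gaussBinom_succ (two_le_of_natCard_eq hq)] at h1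
    refine mul_right_cancel₀ ?_ h1
    exact_mod_cast (qInt_pos q k.succ_pos).ne'

/-- The range `2 * k ≤ n + 1` reaches the upper middle level when n is odd, so together with
`ncard_level_anti` the two middle levels have equal size. -/
lemma ncard_level_mono (hq : Nat.card K = q) (hn : finrank K V = n) {j k : ℕ} (hjk : j ≤ k)
    (hk : 2 * k ≤ n + 1) : (level K V j).ncard ≤ (level K V k).ncard := by
  have := finite_submodule K V
  have := Fintype.ofFinite (Submodule K V)
  induction k, hjk using Nat.le_induction with
  | base => exact le_rfl
  | succ k hjk ih =>
    refine (ih (by omega)).trans (Nat.le_of_mul_le_mul_right ?_ (qInt_pos q k.succ_pos))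
    rw [ncard_level_succ hq hn k]
    exact Nat.mul_le_mul_left _ (qInt_mono q (by omega))

lemma ncard_level_anti (hq : Nat.card K = q) (hn : finrank K V = n) {j k : ℕ} (hjk : j ≤ k)
    (hj : n ≤ 2 * j + 1) : (level K V k).ncard ≤ (level K V j).ncard := by
  have := finite_submodule K V
  have := Fintype.ofFinite (Submodule K V)
  induction k, hjk using Nat.le_induction with
  | base => exact le_rfl
  | succ k hjk ih =>
    refine le_trans (Nat.le_of_mul_le_mul_right ?_ (qInt_pos q k.succ_pos)) ih
    rw [ncard_level_succ hq hn k]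
    exact Nat.mul_le_mul_left _ (qInt_mono q (by omega))

end Finite

end Counting

/-! ### Matched points and lines in a projective plane. -/

section Plane

open scoped Classical

variable {P L : Type*} [Fintype P] [Fintype L] {I : P → L → Prop} {q : ℕ}
  {X : Finset P} {Y : Finset L}

/-- The incidence relation `I` is that of a projective plane of order `q`. -/
structure IsPlane (I : P → L → Prop) (q : ℕ) : Prop where
  card_points : Fintype.card P = q ^ 2 + q + 1
  card_lines : Fintype.card L = q ^ 2 + q + 1
  card_on : ∀ l, #{p | I p l} = q + 1
  card_through : ∀ p, #{l | I p l} = q + 1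
  meet : ∀ l l', l ≠ l' → ∃ p, I p l ∧ I p l'
  join : ∀ p p', p ≠ p' → ∃ l, I p l ∧ I p' l
  unique : ∀ p p' l l', I p l → I p' l → I p l' → I p' l' → p = p' ∨ l = l'

lemma IsPlane.dual (h : IsPlane I q) : IsPlane (fun l p => I p l) q where
  card_points := h.card_lines
  card_lines := h.card_points
  card_on := h.card_through
  card_through := h.card_on
  meet := h.join
  join := h.meet
  unique l l' p p' h1 h2 h3 h4 := (h.unique p p' l l' h1 h3 h2 h4).symm

/-- No point of `X` lies on two lines of `Y` and no line of `Y` passes through two points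
of `X`. -/
structure IsMatched (I : P → L → Prop) (X : Finset P) (Y : Finset L) : Prop where
  point : ∀ p ∈ X, ∀ l ∈ Y, ∀ l' ∈ Y, I p l → I p l' → l = l'
  line : ∀ l ∈ Y, ∀ p ∈ X, ∀ p' ∈ X, I p l → I p' l → p = p'

omit [Fintype P] [Fintype L] in
lemma IsMatched.dual (h : IsMatched I X Y) : IsMatched (fun l p => I p l) Y X :=
  ⟨h.line, h.point⟩

/-- The number of lines of `Y` through a point. -/
noncomputable def lineDegree (I : P → L → Prop) (Y : Finset L) (p : P) : ℕ := #{l ∈ Y | I p l}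

/-- The number of incident pairs in `X × Y`. -/
noncomputable def incidences (I : P → L → Prop) (X : Finset P) (Y : Finset L) : ℕ := ∑ p ∈ X, lineDegree I Y p

omit [Fintype P] [Fintype L] in
lemma incidences_dual (I : P → L → Prop) (X : Finset P) (Y : Finset L) :
    incidences (fun l p => I p l) Y X = incidences I X Y :=
  (Finset.sum_card_bipartiteAbove_eq_sum_card_bipartiteBelow I).symm

omit [Fintype P] [Fintype L] in
lemma IsMatched.lineDegree_le (h : IsMatched I X Y) {p : P} (hp : p ∈ X) :
    lineDegree I Y p ≤ 1 := by
  rw [lineDegree, Finset.card_le_one]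
  intro l hl l' hl'
  rw [Finset.mem_filter] at hl hl'
  exact h.point p hp l hl.1 l' hl'.1 hl.2 hl'.2

omit [Fintype P] [Fintype L] in
lemma IsMatched.incidences_le_left (h : IsMatched I X Y) : incidences I X Y ≤ #X :=
  (Finset.sum_le_sum fun _ hp => h.lineDegree_le hp).trans (by simp)

omit [Fintype P] [Fintype L] in
lemma IsMatched.incidences_le_right (h : IsMatched I X Y) : incidences I X Y ≤ #Y := by
  rw [← incidences_dual]
  exact h.dual.incidences_le_left

lemma IsPlane.sum_lineDegree (h : IsPlane I q) (Y : Finset L) :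
    ∑ p, lineDegree I Y p = (q + 1) * #Y := by
  have := incidences_dual I univ Y
  rw [incidences] at this
  rw [incidences] at this
  rw [← this]
  simp [lineDegree, h.card_on, mul_comm]

lemma IsPlane.card_common (h : IsPlane I q) (l l' : L) :
    #{p | I p l ∧ I p l'} = 1 + if l = l' then q else 0 := by
  split_ifs with hl
  · subst hl
    simp [h.card_on, add_comm]
  · rw [add_zero, Finset.card_eq_one]
    obtain ⟨p, hp⟩ := h.meet l l' hl
    refine ⟨p, ?_⟩
    ext p'
    simp only [Finset.mem_filter_univ, Finset.mem_singleton]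
    refine ⟨fun hp' => ?_, fun e => e ▸ hp⟩
    exact (h.unique p' p l l' hp'.1 hp.1 hp'.2 hp.2).resolve_right hl

/-- Counts ordered pairs of lines of Y with a common point: distinct lines share one point, a line
shares q + 1 points with itself. -/
lemma IsPlane.sum_lineDegree_sq (h : IsPlane I q) (Y : Finset L) :
    ∑ p, lineDegree I Y p ^ 2 = #Y ^ 2 + q * #Y := by
  have h1 : ∀ p, lineDegree I Y p ^ 2
      = ∑ l ∈ Y, ∑ l' ∈ Y, if I p l ∧ I p l' then 1 else 0 := by
    intro p
    rw [lineDegree, sq, Finset.card_filter, Finset.sum_mul_sum]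
    refine Finset.sum_congr rfl fun l _ => Finset.sum_congr rfl fun l' _ => ?_
    by_cases h1 : I p l <;> by_cases h2 : I p l' <;> simp [h1, h2]
  simp only [h1]
  rw [Finset.sum_comm]
  have h2 : ∀ l ∈ Y, ∑ p, ∑ l' ∈ Y, (if I p l ∧ I p l' then 1 else 0) = #Y + q := by
    intro l hl
    rw [Finset.sum_comm]
    simp only [← Finset.card_filter, h.card_common, Finset.sum_add_distrib]
    simp [hl]
  rw [Finset.sum_congr rfl h2]
  simp; ring

lemma IsPlane.sum_compl_lineDegree (h : IsPlane I q) (X : Finset P) (Y : Finset L) :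
    (∑ p ∈ Xᶜ, lineDegree I Y p : ℤ) = (q + 1) * #Y - incidences I X Y := by
  have h1 := h.sum_lineDegree Y
  rw [← Finset.sum_add_sum_compl X] at h1
  rw [incidences]
  have : ((∑ p ∈ X, lineDegree I Y p + ∑ p ∈ Xᶜ, lineDegree I Y p : ℕ) : ℤ)
    = ((q + 1) * #Y : ℕ) := by rw [h1]
  push_cast at this ⊢
  linarith

/-- Points of X have degree 0 or 1, so their squared degrees sum to the number of incidences. -/
lemma IsPlane.sum_compl_lineDegree_sq (h : IsPlane I q) (hm : IsMatched I X Y) :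
    (∑ p ∈ Xᶜ, (lineDegree I Y p : ℤ) ^ 2) = #Y ^ 2 + q * #Y - incidences I X Y := by
  have h1 := h.sum_lineDegree_sq Y
  rw [← Finset.sum_add_sum_compl X] at h1
  have h2 : ∑ p ∈ X, lineDegree I Y p ^ 2 = incidences I X Y := by
    refine Finset.sum_congr rfl fun p hp => ?_
    have := hm.lineDegree_le hp
    interval_cases lineDegree I Y p <;> rfl
  rw [h2] at h1
  have : ((incidences I X Y + ∑ p ∈ Xᶜ, lineDegree I Y p ^ 2 : ℕ) : ℤ)
    = (#Y ^ 2 + q * #Y : ℕ) := by rw [h1]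
  push_cast at this ⊢
  linarith

lemma IsPlane.card_compl (h : IsPlane I q) (X : Finset P) :
    (#Xᶜ : ℤ) = q ^ 2 + q + 1 - #X := by
  have := Finset.card_add_card_compl X
  rw [h.card_points] at this
  have : ((#X + #Xᶜ : ℕ) : ℤ) = (q ^ 2 + q + 1 : ℕ) := by rw [this]
  push_cast at this
  linarith

/-- Nonnegativity of the variance of the degrees over the points outside X. -/
lemma IsPlane.cauchy_schwarz (h : IsPlane I q) (hm : IsMatched I X Y) :
    ((q + 1) * #Y - incidences I X Y : ℤ) ^ 2 ≤
      (q ^ 2 + q + 1 - #X) * (#Y ^ 2 + q * #Y - incidences I X Y) := by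
  rw [← h.sum_compl_lineDegree, ← h.sum_compl_lineDegree_sq hm, ← h.card_compl]
  exact sq_sum_le_card_mul_sum_sq

lemma IsPlane.lower_bound (h : IsPlane I q) (hm : IsMatched I X Y) (hY : 1 ≤ #Y)
    (hXY : #X + #Y = q ^ 2 + q + 1) (hq : 1 ≤ q) : q ^ 2 + 1 ≤ #Y + q := by
  have h1 := h.cauchy_schwarz hm
  have h2 := hm.incidences_le_right
  have h3 : (q ^ 2 + q + 1 - #X : ℤ) = #Y := by
    have : ((#X + #Y : ℕ) : ℤ) = (q ^ 2 + q + 1 : ℕ) := by rw [hXY]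
    push_cast at this
    linarith
  rw [h3] at h1
  zify at *
  generalize (incidences I X Y : ℤ) = e at *
  generalize (#Y : ℤ) = y at *
  generalize (q : ℤ) = r at *
  -- Adding this product to the slack of the Cauchy–Schwarz inequality gives exactly y² (y + r - 1 -
  -- r²), so the unknown e disappears.
  have h4 : 0 ≤ (y - e) * (2 * r * y - e) :=
    mul_nonneg (by linarith) (by nlinarith)
  have h5 : 0 ≤ y ^ 2 * (y + r - 1 - r ^ 2) := by nlinarith
  have h6 : 0 < y ^ 2 := by positivity
  have := nonneg_of_mul_nonneg_right h5 h6
  linarith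

omit [Fintype P] [Fintype L] in
lemma IsMatched.mono (h : IsMatched I X Y) {Y' : Finset L} (hY : Y' ⊆ Y) : IsMatched I X Y' :=
  ⟨fun p hp l hl l' hl' => h.point p hp l (hY hl) l' (hY hl'),
    fun l hl => h.line l (hY hl)⟩

lemma IsPlane.ne_univ (h : IsPlane I q) (hm : IsMatched I X Y) (hY : Y.Nonempty) (hq : 1 ≤ q) :
    X ≠ univ := by
  rintro rfl
  obtain ⟨l, hl⟩ := hY
  have : 1 < #{p | I p l} := by rw [h.card_on]; omega
  obtain ⟨a, ha, b, hb, hab⟩ := Finset.one_lt_card.1 this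
  rw [Finset.mem_filter_univ] at ha hb
  exact hab (hm.line l hl a (mem_univ _) b (mem_univ _) ha hb)

/-- Trim Y to make the total exactly q² + q + 1. Then both parts have at least q² - q + 1 elements,
so q² + 1 ≤ 3q, which leaves only q = 2 and parts of sizes 3 and 4. -/
lemma IsPlane.large_mixed (h : IsPlane I q) (hm : IsMatched I X Y) (hX : X.Nonempty)
    (hY : Y.Nonempty) (hXY : q ^ 2 + q + 1 ≤ #X + #Y) (hq : 2 ≤ q) :
    q = 2 ∧ (#X = 3 ∨ #X = 4) := by
  have h1 : #X < q ^ 2 + q + 1 := by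
    rw [← h.card_points]
    exact (Finset.card_lt_iff_ne_univ X).2 (h.ne_univ hm hY (by omega))
  obtain ⟨Y', hY', hc⟩ := Finset.exists_subset_card_eq (s := Y) (n := q ^ 2 + q + 1 - #X) (by omega)
  have hm' := hm.mono hY'
  have h2 := h.lower_bound hm' (by omega) (by omega) (by omega)
  have h3 := h.dual.lower_bound hm'.dual (by rw [Nat.one_le_iff_ne_zero]; simpa using hX.ne_empty)
    (by omega) (by omega)
  have hq2 : q = 2 := by
    by_contra hne
    have h4 : 3 ≤ q := by omega
    have h5 : q ^ 2 + 1 ≤ 3 * q := by omega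
    nlinarith
  subst hq2
  omega

/-- The pairs `(X, Y)` of maximum total size with neither `X` nor `Y` empty. -/
structure IsMixed (I : P → L → Prop) (X : Finset P) (Y : Finset L) : Prop where
  isPlane : IsPlane I 2
  isMatched : IsMatched I X Y
  incidences_eq : incidences I X Y = 3
  card_eq : #X = 3 ∧ #Y = 4 ∨ #X = 4 ∧ #Y = 3

lemma IsPlane.trichotomy (h : IsPlane I q) (hm : IsMatched I X Y) (hq : 2 ≤ q) :
    #X + #Y ≤ q ^ 2 + q + 1 ∧ (#X + #Y = q ^ 2 + q + 1 →
      (X = univ ∧ Y = ∅) ∨ (X = ∅ ∧ Y = univ) ∨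
        (q = 2 ∧ IsMixed I X Y)) := by
  rcases X.eq_empty_or_nonempty with rfl | hX
  · have h1 := h.card_lines
    refine ⟨?_, fun h2 => Or.inr (Or.inl ⟨rfl, ?_⟩)⟩
    · rw [← h1]; simpa using Finset.card_le_univ Y
    · rw [← Finset.card_eq_iff_eq_univ, h1, ← h2]; simp
  rcases Y.eq_empty_or_nonempty with rfl | hY
  · have h1 := h.card_points
    refine ⟨?_, fun h2 => Or.inl ⟨?_, rfl⟩⟩
    · rw [← h1]; simpa using Finset.card_le_univ X
    · rw [← Finset.card_eq_iff_eq_univ, h1, ← h2]; simp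
  by_cases hXY : q ^ 2 + q + 1 ≤ #X + #Y
  swap
  · exact ⟨by omega, fun h2 => absurd h2.ge hXY⟩
  -- Only q = 2 with sizes 3 or 4 on each side is left. Checking each e ≤ 4 against both
  -- Cauchy–Schwarz inequalities excludes 4 + 4 and forces e = 3 for total 7.
  obtain ⟨rfl, hx⟩ := h.large_mixed hm hX hY hXY hq
  obtain ⟨-, hy⟩ := h.dual.large_mixed hm.dual hY hX (by omega) hq
  have key : #X + #Y ≤ 2 ^ 2 + 2 + 1 ∧ (#X + #Y = 2 ^ 2 + 2 + 1 →
      incidences I X Y = 3 ∧ (#X = 3 ∧ #Y = 4 ∨ #X = 4 ∧ #Y = 3)) := by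
    have h1 := h.cauchy_schwarz hm
    have h2 := h.dual.cauchy_schwarz hm.dual
    rw [incidences_dual] at h2
    have h3 := hm.incidences_le_left
    have h4 := hm.incidences_le_right
    generalize incidences I X Y = e at *
    generalize #X = x at *
    generalize #Y = y at *
    have he : e ≤ 4 := by omega
    rcases hx with rfl | rfl <;> rcases hy with rfl | rfl <;> interval_cases e <;>
      first
      | (exfalso; norm_num at h1; done)
      | (exfalso; norm_num at h2; done)
      | omega
  exact ⟨key.1, fun h2 => Or.inr (Or.inr ⟨rfl, h, hm, (key.2 h2).1, (key.2 h2).2⟩)⟩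

lemma IsMixed.dual (h : IsMixed I X Y) : IsMixed (fun l p => I p l) Y X where
  isPlane := h.isPlane.dual
  isMatched := h.isMatched.dual
  incidences_eq := by rw [incidences_dual, h.incidences_eq]
  card_eq := by have := h.card_eq; omega

/-- Two points of degree 0 would leave at most |X| - 2 ≤ 2 incidences, but there are 3. -/
lemma IsMixed.matched_or_matched (h : IsMixed I X Y) {p p' : P} (hp : p ∈ X) (hp' : p' ∈ X)
    (hne : p ≠ p') : ∃ l ∈ Y, I p l ∨ I p' l := by
  by_contra! hl
  have h0 : ∀ r, (r = p ∨ r = p') → lineDegree I Y r = 0 := by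
    intro r hr
    rw [lineDegree, Finset.card_eq_zero, Finset.filter_eq_empty_iff]
    rintro l hlY hrl
    rcases hr with rfl | rfl
    · exact (hl l hlY).1 hrl
    · exact (hl l hlY).2 hrl
  have h1 := h.incidences_eq
  rw [incidences, ← Finset.sum_erase X (h0 p (Or.inl rfl)),
    ← Finset.sum_erase _ (h0 p' (Or.inr rfl))] at h1
  have h2 : ∑ r ∈ (X.erase p).erase p', lineDegree I Y r ≤ #((X.erase p).erase p') :=
    (Finset.sum_le_sum fun r hr => h.isMatched.lineDegree_le
      (Finset.mem_of_mem_erase (Finset.mem_of_mem_erase hr))).trans (by simp)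
  rw [Finset.card_erase_of_mem (Finset.mem_erase.2 ⟨hne.symm, hp'⟩),
    Finset.card_erase_of_mem hp] at h2
  have := h.card_eq
  omega

/-- The three points outside X have degree sum 6 and square sum 12, so their degrees have mean 2 and
variance 0. -/
lemma IsMixed.lineDegree_eq_two (h : IsMixed I X Y) (hX : #X = 4) {p : P} (hp : p ∉ X) :
    lineDegree I Y p = 2 := by
  have hY : #Y = 3 := by have := h.card_eq; omega
  have h1 := h.isPlane.sum_compl_lineDegree X Y
  have h2 := h.isPlane.sum_compl_lineDegree_sq h.isMatched
  have h3 := h.isPlane.card_compl X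
  rw [h.incidences_eq, hY] at h1 h2
  rw [hX] at h3
  have h4 : ∑ r ∈ Xᶜ, ((lineDegree I Y r : ℤ) - 2) ^ 2 = 0 := by
    simp only [sub_sq, Finset.sum_add_distrib, Finset.sum_sub_distrib]
    rw [h2, ← Finset.sum_mul, ← Finset.mul_sum, h1, Finset.sum_const, nsmul_eq_mul, h3]
    norm_num
  rw [Finset.sum_eq_zero_iff_of_nonneg (fun _ _ => sq_nonneg _)] at h4
  have h5 := h4 p (Finset.mem_compl.2 hp)
  have h6 := pow_eq_zero_iff (two_ne_zero) |>.1 h5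
  omega

/-- Three incidences on three lines, at most one each: every line of Y has exactly one of its three
points in X. -/
lemma IsMixed.card_compl_on_eq_two (h : IsMixed I X Y) (hX : #X = 4) {l : L} (hl : l ∈ Y) :
    #{p ∈ Xᶜ | I p l} = 2 := by
  have hY : #Y = 3 := by have := h.card_eq; omega
  have h1 : ∑ l ∈ Y, lineDegree (fun l p => I p l) X l = ∑ l ∈ Y, 1 := by
    have := h.incidences_eq
    rw [← incidences_dual] at this
    rw [Finset.sum_const, hY]
    exact this
  have h2 := (Finset.sum_eq_sum_iff_of_le
    fun l hl => h.isMatched.dual.lineDegree_le hl).1 h1 l hl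
  have h3 := h.isPlane.card_on l
  have h4 : #{p ∈ X | I p l} + #{p ∈ Xᶜ | I p l} = #{p | I p l} := by
    rw [← Finset.card_union_of_disjoint, ← Finset.filter_union, Finset.union_compl]
    exact Finset.disjoint_filter_filter disjoint_compl_right
  rw [lineDegree] at h2
  omega

/-- Some line carries two points of `X` and a point outside `X`. -/
lemma IsMixed.exists_line (h : IsMixed I X Y) :
    ∃ l p p' r, p ∈ X ∧ p' ∈ X ∧ p ≠ p' ∧ r ∉ X ∧ I p l ∧ I p' l ∧ I r l := by
  rcases h.card_eq with ⟨hX, hY⟩ | ⟨hX, hY⟩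
  · have h1 := h.isPlane.dual.card_compl Y
    have h2 : Yᶜ.Nonempty := by
      rw [← Finset.card_pos]
      rw [hY] at h1
      omega
    obtain ⟨l, hl⟩ := h2
    -- By duality a line outside Y carries exactly two points of X; its third point is r.
    have h3 : #{p ∈ X | I p l} = 2 := h.dual.lineDegree_eq_two hY (Finset.mem_compl.1 hl)
    obtain ⟨p, hp, p', hp', hne⟩ := Finset.one_lt_card.1 (by rw [h3]; norm_num)
    obtain ⟨r, hr, hrX⟩ := Finset.exists_mem_notMem_of_card_lt_card
      (s := {p ∈ X | I p l}) (t := {p | I p l}) (by rw [h3, h.isPlane.card_on]; norm_num)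
    simp only [Finset.mem_filter, Finset.mem_univ, true_and] at hp hp' hr hrX
    exact ⟨l, p, p', r, hp.1, hp'.1, hne, fun h => hrX ⟨h, hr⟩, hp.2, hp'.2, hr⟩
  · have h1 := h.isPlane.card_compl X
    have h2 : Xᶜ.Nonempty := by
      rw [← Finset.card_pos]
      rw [hX] at h1
      omega
    obtain ⟨r, hr⟩ := h2
    rw [Finset.mem_compl] at hr
    have h3 := h.lineDegree_eq_two hX hr
    have h4 := h.isPlane.card_through r
    have h5 : #{l ∈ Y | I r l} + #{l ∈ Yᶜ | I r l} = #{l | I r l} := by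
      rw [← Finset.card_union_of_disjoint, ← Finset.filter_union, Finset.union_compl]
      exact Finset.disjoint_filter_filter disjoint_compl_right
    rw [lineDegree] at h3
    obtain ⟨l, hl⟩ := Finset.card_eq_one.1 (show #{l ∈ Yᶜ | I r l} = 1 by omega)
    -- The three lines through r cover the four points of X. The two in Y carry at most one each, so
    -- the remaining line l carries at least two.
    have h6 : X ⊆ ({l ∈ Y | I r l}.biUnion fun l => {p ∈ X | I p l}) ∪ {p ∈ X | I p l} := by
      intro p hp
      obtain ⟨k, hk, hk'⟩ := h.isPlane.join p r (fun e => hr (e ▸ hp))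
      rw [Finset.mem_union, Finset.mem_biUnion]
      by_cases hkY : k ∈ Y
      · exact Or.inl ⟨k, by simp [hkY, hk'], by simp [hp, hk]⟩
      · have : k ∈ ({l ∈ Yᶜ | I r l} : Finset L) := by simp [hkY, hk']
        rw [hl, Finset.mem_singleton] at this
        subst this
        exact Or.inr (by simp [hp, hk])
    have h7 : #({l ∈ Y | I r l}.biUnion fun l => {p ∈ X | I p l}) ≤ #{l ∈ Y | I r l} * 1 :=
      Finset.card_biUnion_le_card_mul _ _ _ fun l hl =>
        h.isMatched.dual.lineDegree_le (Finset.mem_filter.1 hl).1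
    have h8 := (Finset.card_le_card h6).trans (Finset.card_union_le _ _)
    obtain ⟨p, hp, p', hp', hne⟩ := Finset.one_lt_card.1 (show 1 < #{p ∈ X | I p l} by omega)
    have hrl : l ∈ ({l ∈ Yᶜ | I r l} : Finset L) := by rw [hl]; exact Finset.mem_singleton_self l
    simp only [Finset.mem_filter] at hp hp' hrl
    exact ⟨l, p, p', r, hp.1, hp'.1, hne, hr, hp.2, hp'.2, hrl.2⟩

end Plane

/-! ### Counting automorphisms by the image of a flag step. -/

section Events

open scoped Classical

variable {K V : Type*} [Field K] [AddCommGroup V] [Module K V]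

/-- Used with k = n - 2d: this is the margin by which a member off the middle beats 1/M, and
`two_mul_qInt_succ_le` is the margin for 2/M. -/
lemma qInt_succ_lt {q d k : ℕ} (hq : 2 ≤ q) (hd : 1 ≤ d) (hk : 2 ≤ k) :
    qInt q (d + 1) < q ^ k * qInt q d := by
  have h1 := qInt_pos q hd
  have h2 : q ^ 2 ≤ q ^ k := Nat.pow_le_pow_right (by omega) hk
  have h3 : q ^ 2 * qInt q d ≤ q ^ k * qInt q d := Nat.mul_le_mul_right _ h2
  have h4 : 2 * 1 ≤ q * qInt q d := Nat.mul_le_mul hq h1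
  have h5 : 2 * (q * qInt q d) ≤ q * (q * qInt q d) := Nat.mul_le_mul_right _ hq
  rw [← mul_assoc q, ← sq] at h5
  rw [qInt_succ]
  omega

lemma two_mul_qInt_succ_le {q d k : ℕ} (hq : 2 ≤ q) (hd : 1 ≤ d) (hk : 3 ≤ k) :
    2 * qInt q (d + 1) ≤ q ^ k * qInt q d := by
  obtain ⟨k, rfl⟩ : ∃ m, k = m + 1 := ⟨k - 1, by omega⟩
  have := qInt_succ_lt hq hd (show 2 ≤ k by omega)
  calc 2 * qInt q (d + 1) ≤ q * (q ^ k * qInt q d) := Nat.mul_le_mul hq this.le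
    _ = _ := by rw [pow_succ]; ring

lemma map_map_equiv (g h : V ≃ₗ[K] V) (A : Submodule K V) :
    (A.map (g : V →ₗ[K] V)).map (h : V →ₗ[K] V) = A.map ((h * g : V ≃ₗ[K] V) : V →ₗ[K] V) := by
  rw [← Submodule.map_comp]; rfl

lemma map_equiv_injective (h : V ≃ₗ[K] V) :
    Function.Injective fun A : Submodule K V => A.map (h : V →ₗ[K] V) :=
  Submodule.map_injective_of_injective h.injective

lemma finrank_map_equiv (g : V ≃ₗ[K] V) (A : Submodule K V) :
    finrank K (A.map (g : V →ₗ[K] V)) = finrank K A := LinearEquiv.finrank_map_eq g A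

lemma map_equiv_le_iff (g : V ≃ₗ[K] V) {A B : Submodule K V} :
    A.map (g : V →ₗ[K] V) ≤ B.map (g : V →ₗ[K] V) ↔ A ≤ B :=
  Submodule.map_le_map_iff_of_injective g.injective A B

variable [Finite K] [FiniteDimensional K V] [Fintype (Submodule K V)] [Fintype (V ≃ₗ[K] V)]

omit [Finite K] [Fintype (Submodule K V)] in
lemma card_pair_const {E E' A A' X X' : Submodule K V} (hA : A ≤ A') (hX : X ≤ X')
    (h1 : finrank K A = finrank K X) (h2 : finrank K A' = finrank K X') :
    #{g : V ≃ₗ[K] V | E.map (g : V →ₗ[K] V) = A ∧ E'.map (g : V →ₗ[K] V) = A'} =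
      #{g : V ≃ₗ[K] V | E.map (g : V →ₗ[K] V) = X ∧ E'.map (g : V →ₗ[K] V) = X'} := by
  obtain ⟨h, rfl, rfl⟩ := Submodule.exists_map_equiv_eq_pair hA hX h1 h2
  refine Finset.card_equiv (Equiv.mulLeft h) fun g => ?_
  rw [Finset.mem_filter_univ, Finset.mem_filter_univ, Equiv.coe_mulLeft, ← map_map_equiv,
    ← map_map_equiv, (map_equiv_injective h).eq_iff, (map_equiv_injective h).eq_iff]

omit [Finite K] in
-- By transitivity the image of E is equidistributed over the subspaces of its dimension.
lemma card_map_eq_mul {E A : Submodule K V} (h : finrank K E = finrank K A) :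
    #{g : V ≃ₗ[K] V | E.map (g : V →ₗ[K] V) = A} * (level K V (finrank K A)).ncard =
      Fintype.card (V ≃ₗ[K] V) := by
  have hc : ∀ X ∈ ({X : Submodule K V | finrank K X = finrank K A} : Finset _),
      #{g : V ≃ₗ[K] V | E.map (g : V →ₗ[K] V) = X} =
        #{g : V ≃ₗ[K] V | E.map (g : V →ₗ[K] V) = A} := by
    intro X hX
    rw [Finset.mem_filter_univ] at hX
    have := card_pair_const (E := E) (E' := E) (le_refl A) (le_refl X) hX.symm hX.symm
    simpa using this.symm
  rw [← Finset.card_univ, Finset.card_eq_sum_card_fiberwise (s := univ)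
    (f := fun g : V ≃ₗ[K] V => E.map (g : V →ₗ[K] V))
    (t := {X : Submodule K V | finrank K X = finrank K A}), ncard_level]
  · rw [Finset.sum_congr rfl hc, Finset.sum_const, smul_eq_mul, mul_comm]
  · intro g _
    simp only [Finset.coe_filter, Finset.mem_univ, true_and, Set.mem_ofPred_eq]
    rw [finrank_map_equiv, h]

/-- Here c counts the automorphisms with both images prescribed. It does not depend on the
prescribed cover of A, so only the covers of A inside B have to be counted. -/
lemma card_flag_above {q : ℕ} (hq : Nat.card K = q) {E E' A : Submodule K V} (hE : E ≤ E')
    (hd : finrank K E' = finrank K A + 1) :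
    ∃ c, ∀ B, A ≤ B →
      #{g : V ≃ₗ[K] V | E.map (g : V →ₗ[K] V) = A ∧ E'.map (g : V →ₗ[K] V) ≤ B} =
        c * qInt q (finrank K B - finrank K A) := by
  by_cases hA : ∃ A' : Submodule K V, A ≤ A' ∧ finrank K A' = finrank K A + 1
  · obtain ⟨A', hA', hdA'⟩ := hA
    refine ⟨#{g : V ≃ₗ[K] V | E.map (g : V →ₗ[K] V) = A ∧ E'.map (g : V →ₗ[K] V) = A'},
      fun B hB => ?_⟩
    rw [← card_atoms hq hB, mul_comm, Finset.card_eq_sum_card_fiberwise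
      (f := fun g : V ≃ₗ[K] V => E'.map (g : V →ₗ[K] V))
      (t := {X : Submodule K V | (A ≤ X ∧ X ≤ B) ∧ finrank K X = finrank K A + 1}),
      ← smul_eq_mul, ← Finset.sum_const]
    · refine Finset.sum_congr rfl fun X hX => ?_
      rw [Finset.mem_filter_univ] at hX
      rw [card_pair_const hA' hX.1.1 rfl (hdA'.trans hX.2.symm), Finset.filter_filter]
      congr 1
      ext g
      simp only [Finset.mem_filter_univ]
      constructor
      · rintro ⟨⟨h1, -⟩, h2⟩; exact ⟨h1, h2⟩
      · rintro ⟨h1, h2⟩; exact ⟨⟨h1, h2 ▸ hX.1.2⟩, h2⟩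
    · intro g hg
      simp only [Finset.coe_filter, Finset.mem_univ, true_and, Set.mem_ofPred_eq] at hg ⊢
      refine ⟨⟨?_, hg.2⟩, ?_⟩
      · rw [← hg.1]; exact Submodule.map_mono hE
      · rw [finrank_map_equiv, hd]
  -- If A has no cover, no automorphism sends E to A, since the image of E' would be a cover.
  · refine ⟨0, fun B hB => ?_⟩
    rw [zero_mul, Finset.card_eq_zero, Finset.filter_eq_empty_iff]
    rintro g - ⟨h1, -⟩
    refine hA ⟨E'.map (g : V →ₗ[K] V), ?_, ?_⟩
    · rw [← h1]; exact Submodule.map_mono hE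
    · rw [finrank_map_equiv, hd]

lemma card_flag_below {q : ℕ} (hq : Nat.card K = q) {E E' D : Submodule K V} (hE : E' ≤ E)
    (hd : finrank K E' + 1 = finrank K D) :
    ∃ c, ∀ B, B ≤ D →
      #{g : V ≃ₗ[K] V | E.map (g : V →ₗ[K] V) = D ∧ B ≤ E'.map (g : V →ₗ[K] V)} =
        c * qInt q (finrank K D - finrank K B) := by
  by_cases hD : ∃ D' : Submodule K V, D' ≤ D ∧ finrank K D' + 1 = finrank K D
  · obtain ⟨D', hD', hdD'⟩ := hD
    refine ⟨#{g : V ≃ₗ[K] V | E'.map (g : V →ₗ[K] V) = D' ∧ E.map (g : V →ₗ[K] V) = D},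
      fun B hB => ?_⟩
    rw [← card_coatoms hq hB, mul_comm, Finset.card_eq_sum_card_fiberwise
      (f := fun g : V ≃ₗ[K] V => E'.map (g : V →ₗ[K] V))
      (t := {X : Submodule K V | (B ≤ X ∧ X ≤ D) ∧ finrank K X + 1 = finrank K D}),
      ← smul_eq_mul, ← Finset.sum_const]
    · refine Finset.sum_congr rfl fun X hX => ?_
      rw [Finset.mem_filter_univ] at hX
      rw [card_pair_const hD' hX.1.2 (by omega) rfl, Finset.filter_filter]
      congr 1
      ext g
      simp only [Finset.mem_filter_univ]
      constructor
      · rintro ⟨⟨h1, -⟩, h2⟩; exact ⟨h2, h1⟩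
      · rintro ⟨h1, h2⟩; exact ⟨⟨h2, h1 ▸ hX.1.1⟩, h1⟩
    · intro g hg
      simp only [Finset.coe_filter, Finset.mem_univ, true_and, Set.mem_ofPred_eq] at hg ⊢
      refine ⟨⟨hg.2, ?_⟩, ?_⟩
      · rw [← hg.1]; exact Submodule.map_mono hE
      · rw [finrank_map_equiv, hd]
  · refine ⟨0, fun B hB => ?_⟩
    rw [zero_mul, Finset.card_eq_zero, Finset.filter_eq_empty_iff]
    rintro g - ⟨h1, -⟩
    refine hD ⟨E'.map (g : V →ₗ[K] V), ?_, ?_⟩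
    · rw [← h1]; exact Submodule.map_mono hE
    · rw [finrank_map_equiv, hd]

/-- The arithmetic shared by `card_event_above` and `card_event_below`. -/
lemma event_bound {q n d γ e r c L L' M : ℕ} (hq : 2 ≤ q) (hd : 1 ≤ d) (hdn : 2 * d + 2 ≤ n)
    (hγ : 0 < γ) (htot : e + c * r = c * qInt q (n - d)) (hL : c * qInt q (n - d) * L = γ)
    (hr : r ≤ qInt q (n - 2 * d)) (hL' : L' * qInt q (d + 1) = L * qInt q (n - d))
    (hM : L' ≤ M) : γ < e * M ∧ (2 * d + 3 ≤ n → 2 * γ ≤ e * M) := by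
  -- In the applications L is the size of the level of the given member and L' that of the next
  -- level towards the middle. Of the [n - d] possible next steps, at most [n - 2d] stay inside the
  -- obstacle, so at least q^(n - 2d) [d] escape it.
  have h1 : qInt q (n - d) = qInt q (n - 2 * d) + q ^ (n - 2 * d) * qInt q d := by
    rw [← qInt_add]; congr 1; omega
  have h2 : c * (q ^ (n - 2 * d) * qInt q d) ≤ e := by
    have := Nat.mul_le_mul_left c hr
    rw [h1] at htot
    nlinarith
  have h3 : γ ≤ c * M * qInt q (d + 1) := by
    calc γ = c * (L' * qInt q (d + 1)) := by rw [hL', ← hL]; ring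
      _ ≤ c * (M * qInt q (d + 1)) := Nat.mul_le_mul_left _ (Nat.mul_le_mul_right _ hM)
      _ = _ := by ring
  have h4 : 0 < c * M := by
    by_contra h
    have : c * M = 0 := by omega
    rw [this] at h3
    omega
  have h5 : c * M * (q ^ (n - 2 * d) * qInt q d) ≤ e * M := by
    calc _ = c * (q ^ (n - 2 * d) * qInt q d) * M := by ring
      _ ≤ e * M := Nat.mul_le_mul_right _ h2
  constructor
  · have := qInt_succ_lt hq hd (show 2 ≤ n - 2 * d by omega)
    exact (h3.trans_lt (Nat.mul_lt_mul_of_pos_left this h4)).trans_le h5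
  · intro h
    have := two_mul_qInt_succ_le hq hd (show 3 ≤ n - 2 * d by omega)
    calc 2 * γ ≤ c * M * (2 * qInt q (d + 1)) := by linarith
      _ ≤ _ := Nat.mul_le_mul_left _ this
      _ ≤ _ := h5

lemma card_event_above {q n : ℕ} (hq : Nat.card K = q) (hn : finrank K V = n)
    {E E' A B : Submodule K V} (hE : E ≤ E') (hEA : finrank K E = finrank K A)
    (hE' : finrank K E' = finrank K A + 1) (hAB : A ≤ B) (hB : finrank K B + finrank K A ≤ n)
    (hd : 1 ≤ finrank K A) (hdn : 2 * finrank K A + 2 ≤ n) :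
    Fintype.card (V ≃ₗ[K] V) <
        #{g : V ≃ₗ[K] V | E.map (g : V →ₗ[K] V) = A ∧ ¬ E'.map (g : V →ₗ[K] V) ≤ B} *
          (level K V (n / 2)).ncard ∧
      (2 * finrank K A + 3 ≤ n → 2 * Fintype.card (V ≃ₗ[K] V) ≤
        #{g : V ≃ₗ[K] V | E.map (g : V →ₗ[K] V) = A ∧ ¬ E'.map (g : V →ₗ[K] V) ≤ B} *
          (level K V (n / 2)).ncard) := by
  obtain ⟨c, hc⟩ := card_flag_above hq hE hE'
  have h1 := hc ⊤ le_top
  simp only [le_top, and_true, finrank_top, hn] at h1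
  have h2 := hc B hAB
  have h3 := card_map_eq_mul hEA
  have h4 := Finset.card_filter_add_card_filter_not
    (s := {g : V ≃ₗ[K] V | E.map (g : V →ₗ[K] V) = A}) (fun g => E'.map (g : V →ₗ[K] V) ≤ B)
  rw [Finset.filter_filter, Finset.filter_filter, h1, h2, add_comm] at h4
  rw [h1] at h3
  exact event_bound (two_le_of_natCard_eq hq) hd hdn Fintype.card_pos h4 h3
    (qInt_mono q (by omega)) (ncard_level_succ hq hn _)
    (ncard_level_mono hq hn (by omega) (by omega))

lemma card_event_below {q n : ℕ} (hq : Nat.card K = q) (hn : finrank K V = n)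
    {E E' D B : Submodule K V} (hE : E' ≤ E) (hED : finrank K E = finrank K D)
    (hE' : finrank K E' + 1 = finrank K D) (hBD : B ≤ D) (hB : n ≤ finrank K B + finrank K D)
    (hd : finrank K D < n) (hdn : n + 2 ≤ 2 * finrank K D) :
    Fintype.card (V ≃ₗ[K] V) <
        #{g : V ≃ₗ[K] V | E.map (g : V →ₗ[K] V) = D ∧ ¬ B ≤ E'.map (g : V →ₗ[K] V)} *
          (level K V (n / 2)).ncard ∧
      (n + 3 ≤ 2 * finrank K D → 2 * Fintype.card (V ≃ₗ[K] V) ≤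
        #{g : V ≃ₗ[K] V | E.map (g : V →ₗ[K] V) = D ∧ ¬ B ≤ E'.map (g : V →ₗ[K] V)} *
          (level K V (n / 2)).ncard) := by
  obtain ⟨c, hc⟩ := card_flag_below hq hE hE'
  have h1 := hc ⊥ bot_le
  simp only [bot_le, and_true, finrank_bot, Nat.sub_zero] at h1
  have h2 := hc B hBD
  have h3 := card_map_eq_mul hED
  have h4 := Finset.card_filter_add_card_filter_not
    (s := {g : V ≃ₗ[K] V | E.map (g : V →ₗ[K] V) = D}) (fun g => B ≤ E'.map (g : V →ₗ[K] V))
  rw [Finset.filter_filter, Finset.filter_filter, h1, h2, add_comm] at h4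
  rw [h1] at h3
  have h5 := ncard_level_succ (V := V) hq hn (finrank K D - 1)
  rw [show finrank K D - 1 + 1 = finrank K D by omega,
    show n - (finrank K D - 1) = n - finrank K D + 1 by omega] at h5
  have e : n - (n - finrank K D) = finrank K D := by omega
  -- The codimension of D plays the part of d, and `h5` read backwards is the recursion towards the
  -- middle.
  have := event_bound (n := n) (d := n - finrank K D) (two_le_of_natCard_eq hq) (by omega)
    (by omega) Fintype.card_pos (by rw [e]; exact h4) (by rw [e]; exact h3)
    (qInt_mono q (by omega)) (by rw [e]; exact h5.symm)
    (ncard_level_anti (k := finrank K D - 1) (j := n / 2) hq hn (by omega) (by omega))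
  exact ⟨this.1, fun h => this.2 (by omega)⟩

end Events

/-! ### Fork-free families, flag events, and even dimension. -/

section Free

open scoped Classical

variable {K V : Type*} [Field K] [AddCommGroup V] [Module K V]

/-- Any two members of `F` with a common lower bound, or a common upper bound, in `F` are
comparable. -/
structure IsForkFree (F : Set (Submodule K V)) : Prop where
  up : ∀ A ∈ F, ∀ B ∈ F, ∀ C ∈ F, A ≤ B → A ≤ C → B ≤ C ∨ C ≤ B
  down : ∀ A ∈ F, ∀ B ∈ F, ∀ C ∈ F, B ≤ A → C ≤ A → B ≤ C ∨ C ≤ B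

lemma VPoset.le_iff (a b : VPoset) : a ≤ b ↔ a = b ∨ a = VPoset.z := Iff.rfl

/-- The embedding of `VPoset` with prescribed images of its three elements. -/
def VPoset.embed {α : Type*} [PartialOrder α] (a b c : α) (hb : a ≤ b) (hc : a ≤ c)
    (hbc : ¬ b ≤ c) (hcb : ¬ c ≤ b) : VPoset ↪o α :=
  OrderEmbedding.ofMapLEIff (fun | .x => b | .y => c | .z => a) (by
    have h1 : ¬ b ≤ a := fun h => hbc (h.trans hc)
    have h2 : ¬ c ≤ a := fun h => hcb (h.trans hb)
    rintro (_ | _ | _) (_ | _ | _) <;> simp_all [VPoset.le_iff])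

lemma isInducedFree_VLambda_iff (F : Set (Submodule K V)) :
    IsInducedFree VLambda F ↔ IsForkFree F := by
  constructor
  · intro h
    have hV := h (PartOrd.of VPoset) (by simp [VLambda])
    have hL := h (PartOrd.of LambdaPoset) (by simp [VLambda])
    constructor
    · intro A hA B hB C hC hAB hAC
      by_contra! hn
      exact hV.false (VPoset.embed (α := F) ⟨A, hA⟩ ⟨B, hB⟩ ⟨C, hC⟩ hAB hAC hn.1 hn.2)
    · intro A hA B hB C hC hAB hAC
      by_contra! hn
      exact hL.false ((VPoset.embed (α := (F : Type _)ᵒᵈ) (OrderDual.toDual ⟨A, hA⟩)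
        (OrderDual.toDual ⟨B, hB⟩) (OrderDual.toDual ⟨C, hC⟩) hAB hAC hn.2 hn.1).dual)
  · intro h P hP
    simp only [VLambda, Set.mem_insert_iff, Set.mem_singleton_iff] at hP
    rcases hP with rfl | rfl
    · constructor
      intro (f : VPoset ↪o F)
      have h1 : f .z ≤ f .x := f.le_iff_le.2 (Or.inr rfl)
      have h2 : f .z ≤ f .y := f.le_iff_le.2 (Or.inr rfl)
      rcases h.up _ (f .z).2 _ (f .x).2 _ (f .y).2 h1 h2 with h3 | h3
      · have := f.le_iff_le.1 (show f .x ≤ f .y from h3)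
        simp [VPoset.le_iff] at this
      · have := f.le_iff_le.1 (show f .y ≤ f .x from h3)
        simp [VPoset.le_iff] at this
    · constructor
      intro (f : VPosetᵒᵈ ↪o F)
      have h1 : f (.toDual .x) ≤ f (.toDual .z) := f.le_iff_le.2 (Or.inr rfl)
      have h2 : f (.toDual .y) ≤ f (.toDual .z) := f.le_iff_le.2 (Or.inr rfl)
      rcases h.down _ (f (.toDual .z)).2 _ (f (.toDual .x)).2 _ (f (.toDual .y)).2 h1 h2
        with h3 | h3
      · have := f.le_iff_le.1 (show f (.toDual .x) ≤ f (.toDual .y) from h3)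
        simp [VPoset.le_iff] at this
      · have := f.le_iff_le.1 (show f (.toDual .y) ≤ f (.toDual .x) from h3)
        simp [VPoset.le_iff] at this

lemma eq_of_comparable_of_finrank_eq [FiniteDimensional K V] {A B : Submodule K V}
    (h : A ≤ B ∨ B ≤ A) (hd : finrank K A = finrank K B) : A = B := by
  rcases h with h | h
  · exact Submodule.eq_of_le_of_finrank_eq h hd
  · exact (Submodule.eq_of_le_of_finrank_eq h hd.symm).symm

lemma isForkFree_level [FiniteDimensional K V] (k : ℕ) : IsForkFree (level K V k) where
  up _ hA _ hB _ _ hAB hAC :=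
    Or.inl (Submodule.eq_of_le_of_finrank_eq hAB (hA.trans hB.symm) ▸ hAC)
  down _ hA _ _ _ hC hBA hCA :=
    Or.inl (hBA.trans (Submodule.eq_of_le_of_finrank_eq hCA (hC.trans hA.symm)).ge)

lemma ncard_le_of_chain [FiniteDimensional K V] {F : Set (Submodule K V)}
    (hF : ∀ A ∈ F, ∀ B ∈ F, A ≤ B ∨ B ≤ A) : F.ncard ≤ finrank K V + 1 := by
  have := Set.ncard_le_ncard_of_injOn (s := F) (t := (Finset.range (finrank K V + 1) : Set ℕ))
    (fun A => finrank K A) (fun A _ => by simpa [Nat.lt_succ_iff] using A.finrank_le)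
    (fun A hA B hB h => eq_of_comparable_of_finrank_eq (hF A hA B hB) h)
  simpa using this

/-- A complete flag of a space of dimension `n`, indexed by dimension. -/
structure IsFullFlag (E : ℕ → Submodule K V) (n : ℕ) : Prop where
  mono : Monotone E
  finrank_eq : ∀ j ≤ n, finrank K (E j) = j

lemma exists_isFullFlag [FiniteDimensional K V] {n : ℕ} (hn : finrank K V = n) :
    ∃ E : ℕ → Submodule K V, IsFullFlag E n := by
  let b := Module.finBasisOfFinrankEq K V hn
  refine ⟨fun j => Submodule.span K (b '' {i | (i : ℕ) < j}), fun i j hij => ?_, fun j hj => ?_⟩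
  · exact Submodule.span_mono (Set.image_mono fun x hx => lt_of_lt_of_le hx hij)
  · have h := finrank_span_set_eq_card (R := K) (s := b '' {i | (i : ℕ) < j})
      ((b.linearIndependent.linearIndepOn_id).mono (Set.image_subset_range _ _))
    rw [h, Set.toFinset_card, ← Nat.card_eq_fintype_card, Nat.card_coe_set_eq,
      Set.ncard_image_of_injective _ b.injective, ← Nat.card_coe_set_eq, Nat.card_eq_fintype_card,
      Fintype.card_subtype]
    simp only [Set.mem_ofPred_eq]
    rw [Fin.card_filter_val_lt]
    omega

variable [Fintype (V ≃ₗ[K] V)] {F : Set (Submodule K V)} {E : ℕ → Submodule K V} {n : ℕ}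

/-- The automorphisms that move the flag `E` so that it passes through `A` and through no other
member of `F` whose dimension is between `finrank K A` and `n - finrank K A`. -/
noncomputable def flagEvent (F : Set (Submodule K V)) (E : ℕ → Submodule K V) (n : ℕ)
    (A : Submodule K V) : Finset (V ≃ₗ[K] V) :=
  {g | (E (finrank K A)).map (g : V →ₗ[K] V) = A ∧
    ∀ j, j ≠ finrank K A → min (finrank K A) (n - finrank K A) ≤ j →
      j ≤ max (finrank K A) (n - finrank K A) → (E j).map (g : V →ₗ[K] V) ∉ F}

/-- If one flag passed through both, the member with dimension closer to n/2 would lie in the window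
of the other, where no further member is allowed. -/
lemma disjoint_flagEvent [FiniteDimensional K V] (hn : finrank K V = n) {A B : Submodule K V}
    (hA : A ∈ F) (hB : B ∈ F) (hAB : A ≠ B) :
    Disjoint (flagEvent F E n A) (flagEvent F E n B) := by
  rw [Finset.disjoint_left]
  intro g hgA hgB
  rw [flagEvent, Finset.mem_filter_univ] at hgA hgB
  have h1 : finrank K A ≠ finrank K B := by
    intro h
    apply hAB
    rw [← hgA.1, ← hgB.1, h]
  have h2 := A.finrank_le
  have h3 := B.finrank_le
  have h4 : (min (finrank K A) (n - finrank K A) ≤ finrank K B ∧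
      finrank K B ≤ max (finrank K A) (n - finrank K A)) ∨
    (min (finrank K B) (n - finrank K B) ≤ finrank K A ∧
      finrank K A ≤ max (finrank K B) (n - finrank K B)) := by omega
  rcases h4 with h4 | h4
  · exact hgA.2 _ h1.symm h4.1 h4.2 (hgB.1.symm ▸ hB)
  · exact hgB.2 _ h1 h4.1 h4.2 (hgA.1.symm ▸ hA)

variable [Finite K] [FiniteDimensional K V] [Fintype (Submodule K V)] {q : ℕ}

lemma lt_card_flagEvent (hq : Nat.card K = q) (hn : finrank K V = n) (hE : IsFullFlag E n)
    (hF : IsForkFree F) {A : Submodule K V} (hA : A ∈ F) (hd : 1 ≤ finrank K A)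
    (hdn : finrank K A < n) (hmid : 2 * finrank K A + 2 ≤ n ∨ n + 2 ≤ 2 * finrank K A) :
    Fintype.card (V ≃ₗ[K] V) < #(flagEvent F E n A) * (level K V (n / 2)).ncard ∧
      (2 * finrank K A + 3 ≤ n ∨ n + 3 ≤ 2 * finrank K A →
        2 * Fintype.card (V ≃ₗ[K] V) ≤ #(flagEvent F E n A) * (level K V (n / 2)).ncard) := by
  rcases hmid with hmid | hmid
  -- B is the top of the chain of members above A within the window (possibly A itself). A flag
  -- through A that meets another member in the window has its step after A inside B, so leaving B
  -- at once avoids them all.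
  · obtain ⟨B, hB, hBmax⟩ := Finset.exists_max_image
      ({C : Submodule K V | C ∈ F ∧ A ≤ C ∧ finrank K C + finrank K A ≤ n} : Finset _)
      (fun C => finrank K C) ⟨A, by simp only [Finset.mem_filter_univ]; exact ⟨hA, le_rfl, by omega⟩⟩
    simp only [Finset.mem_filter_univ] at hB hBmax
    have hsub : ({g : V ≃ₗ[K] V | (E (finrank K A)).map (g : V →ₗ[K] V) = A ∧
        ¬ (E (finrank K A + 1)).map (g : V →ₗ[K] V) ≤ B} : Finset _) ⊆ flagEvent F E n A := by
      intro g hg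
      rw [flagEvent, Finset.mem_filter_univ]
      rw [Finset.mem_filter_univ] at hg
      refine ⟨hg.1, fun j hj h1 h2 hjF => hg.2 ?_⟩
      have h3 : A ≤ (E j).map (g : V →ₗ[K] V) := by
        conv_lhs => rw [← hg.1]
        exact Submodule.map_mono (hE.mono (by omega))
      have h4 : finrank K ((E j).map (g : V →ₗ[K] V)) = j := by
        rw [finrank_map_equiv, hE.finrank_eq j (by omega)]
      have h5 := hBmax _ ⟨hjF, h3, by omega⟩
      have h6 : (E j).map (g : V →ₗ[K] V) ≤ B := by
        rcases hF.up A hA _ hjF B hB.1 h3 hB.2.1 with h | h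
        · exact h
        · exact (Submodule.eq_of_le_of_finrank_le h h5).ge
      exact (Submodule.map_mono (hE.mono (by omega))).trans h6
    have h := card_event_above hq hn (hE.mono (Nat.le_succ (finrank K A)))
      (hE.finrank_eq _ (by omega)) (hE.finrank_eq _ (by omega)) hB.2.1 hB.2.2 hd hmid
    have h' := Nat.mul_le_mul_right (level K V (n / 2)).ncard (Finset.card_le_card hsub)
    exact ⟨h.1.trans_le h', fun h'' => (h.2 (by omega)).trans h'⟩
  · obtain ⟨B, hB, hBmin⟩ := Finset.exists_min_image
      ({C : Submodule K V | C ∈ F ∧ C ≤ A ∧ n ≤ finrank K C + finrank K A} : Finset _)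
      (fun C => finrank K C) ⟨A, by simp only [Finset.mem_filter_univ]; exact ⟨hA, le_rfl, by omega⟩⟩
    simp only [Finset.mem_filter_univ] at hB hBmin
    have hsub : ({g : V ≃ₗ[K] V | (E (finrank K A)).map (g : V →ₗ[K] V) = A ∧
        ¬ B ≤ (E (finrank K A - 1)).map (g : V →ₗ[K] V)} : Finset _) ⊆ flagEvent F E n A := by
      intro g hg
      rw [flagEvent, Finset.mem_filter_univ]
      rw [Finset.mem_filter_univ] at hg
      refine ⟨hg.1, fun j hj h1 h2 hjF => hg.2 ?_⟩
      have h3 : (E j).map (g : V →ₗ[K] V) ≤ A := by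
        conv_rhs => rw [← hg.1]
        exact Submodule.map_mono (hE.mono (by omega))
      have h4 : finrank K ((E j).map (g : V →ₗ[K] V)) = j := by
        rw [finrank_map_equiv, hE.finrank_eq j (by omega)]
      have h5 := hBmin _ ⟨hjF, h3, by omega⟩
      have h6 : B ≤ (E j).map (g : V →ₗ[K] V) := by
        rcases hF.down A hA _ hjF B hB.1 h3 hB.2.1 with h | h
        · exact (Submodule.eq_of_le_of_finrank_le h h5).ge
        · exact h
      exact h6.trans (Submodule.map_mono (hE.mono (by omega)))
    have h := card_event_below hq hn (hE.mono (Nat.sub_le (finrank K A) 1))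
      (hE.finrank_eq _ (by omega)) (by rw [hE.finrank_eq _ (by omega)]; omega) hB.2.1 hB.2.2
      hdn hmid
    have h' := Nat.mul_le_mul_right (level K V (n / 2)).ncard (Finset.card_le_card hsub)
    exact ⟨h.1.trans_le h', fun h'' => (h.2 (by omega)).trans h'⟩

omit [Finite K] in
-- The window of a middle member is the single dimension m, so the event only asks that the flag
-- pass through A.
lemma card_flagEvent_middle {m : ℕ} (hE : IsFullFlag E (2 * m)) {A : Submodule K V}
    (hA : finrank K A = m) :
    #(flagEvent F E (2 * m) A) * (level K V m).ncard = Fintype.card (V ≃ₗ[K] V) := by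
  rw [← card_map_eq_mul (E := E m) (A := A) (by rw [hE.finrank_eq _ (by omega), hA]), hA, flagEvent]
  congr 2
  ext g
  rw [Finset.mem_filter_univ, Finset.mem_filter_univ, hA, and_iff_left_iff_imp]
  intro _ j
  omega

omit [Finite K] [Fintype (Submodule K V)] in
lemma sum_card_flagEvent_le (hn : finrank K V = n) (S : Finset (Submodule K V)) (hS : ↑S ⊆ F) :
    ∑ A ∈ S, #(flagEvent F E n A) ≤ Fintype.card (V ≃ₗ[K] V) := by
  rw [← Finset.card_biUnion]
  · exact Finset.card_le_univ _
  · intro A hA B hB hAB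
    exact disjoint_flagEvent hn (hS hA) (hS hB) hAB

omit [Fintype (V ≃ₗ[K] V)] [Finite K] [Fintype (Submodule K V)] in
lemma finrank_pos_of_ne_bot {A : Submodule K V} (h : A ≠ ⊥) : 1 ≤ finrank K A := by
  rw [Nat.one_le_iff_ne_zero]
  exact fun h' => h (Submodule.finrank_eq_zero.1 h')

omit [Fintype (V ≃ₗ[K] V)] [Finite K] [FiniteDimensional K V] in
lemma ncard_eq_card_filter (F : Set (Submodule K V)) : F.ncard = #{A | A ∈ F} := by
  rw [Set.ncard_eq_toFinset_card']
  congr 1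
  ext X
  rw [Set.mem_toFinset, Finset.mem_filter_univ]

lemma even_case {m : ℕ} (hq : Nat.card K = q) (hn : finrank K V = 2 * m) (hF : IsForkFree F)
    (hbot : ⊥ ∉ F) (htop : ⊤ ∉ F) :
    F.ncard ≤ (level K V m).ncard ∧ (F.ncard = (level K V m).ncard → F ⊆ level K V m) := by
  obtain ⟨E, hE⟩ := exists_isFullFlag hn
  set γ := Fintype.card (V ≃ₗ[K] V) with hγ
  have hγ0 : 0 < γ := Fintype.card_pos
  have h1 : ∀ A ∈ F, finrank K A ≠ m → γ < #(flagEvent F E (2 * m) A) * (level K V m).ncard := by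
    intro A hA hAm
    have h2 : 1 ≤ finrank K A := finrank_pos_of_ne_bot fun h => hbot (h ▸ hA)
    have h3 : finrank K A < 2 * m := hn ▸ Submodule.finrank_lt fun h => htop (h ▸ hA)
    have := (lt_card_flagEvent hq hn hE hF hA h2 h3 (by omega)).1
    rwa [Nat.mul_div_cancel_left _ two_pos] at this
  have h2 : ∀ A ∈ F, γ ≤ #(flagEvent F E (2 * m) A) * (level K V m).ncard := by
    intro A hA
    by_cases hAm : finrank K A = m
    · exact (card_flagEvent_middle hE hAm).ge
    · exact (h1 A hA hAm).le
  have h3 : ∑ A with A ∈ F, #(flagEvent F E (2 * m) A) * (level K V m).ncard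
      ≤ γ * (level K V m).ncard := by
    rw [← Finset.sum_mul]
    exact Nat.mul_le_mul_right _ (sum_card_flagEvent_le hn _ (by intro A; simp))
  have h4 : F.ncard * γ = ∑ A with A ∈ F, γ := by
    rw [Finset.sum_const, smul_eq_mul, ncard_eq_card_filter]
  constructor
  · refine Nat.le_of_mul_le_mul_right ?_ hγ0
    rw [h4, mul_comm _ γ]
    exact (Finset.sum_le_sum fun A hA => h2 A (by simpa using hA)).trans h3
  · intro heq A hA
    by_contra hAm
    have h5 : ∑ A with A ∈ F, γ < ∑ A with A ∈ F, #(flagEvent F E (2 * m) A) * (level K V m).ncard :=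
      Finset.sum_lt_sum (fun A hA => h2 A (by simpa using hA))
        ⟨A, by simpa using hA, h1 A hA hAm⟩
    rw [← h4, heq, mul_comm _ γ] at h5
    exact absurd h3 h5.not_ge

end Free

/-! ### Odd dimension: averaging over the planes between dimensions m - 1 and m + 2. -/

section Odd

open scoped Classical

variable {K V : Type*} [Field K] [AddCommGroup V] [Module K V]

lemma card_filter_subtype {α : Type*} [Fintype α] (p q : α → Prop) [Fintype {x // p x}]
    [DecidablePred q] [DecidablePred fun x => p x ∧ q x] :
    #{x : {x // p x} | q x.1} = #{x | p x ∧ q x} := by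
  rw [← Fintype.card_subtype, ← Fintype.card_subtype]
  exact Fintype.card_congr (Equiv.subtypeSubtypeEquivSubtypeInter p q)

/-- The points of the interval from `S` to `T`: the subspaces one dimension above `S`. -/
abbrev PointsBetween (S T : Submodule K V) : Type _ :=
  {X : Submodule K V // (S ≤ X ∧ X ≤ T) ∧ finrank K X = finrank K S + 1}

/-- The hyperplanes of the interval from `S` to `T`: the subspaces one dimension below `T`. -/
abbrev LinesBetween (S T : Submodule K V) : Type _ :=
  {X : Submodule K V // (S ≤ X ∧ X ≤ T) ∧ finrank K X + 1 = finrank K T}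

/-- Inclusion between points and hyperplanes of an interval. -/
abbrev incidenceBetween (S T : Submodule K V) (p : PointsBetween S T) (l : LinesBetween S T) :
    Prop := p.1 ≤ l.1

variable [FiniteDimensional K V] [Fintype (Submodule K V)] {q n : ℕ} {F : Set (Submodule K V)}
  {S T : Submodule K V}

lemma qInt_three (q : ℕ) : qInt q 3 = q ^ 2 + q + 1 := by
  simp [qInt, Finset.sum_range_succ]; ring

lemma qInt_two (q : ℕ) : qInt q 2 = q + 1 := by
  simp [qInt, Finset.sum_range_succ, add_comm]

omit [Fintype (Submodule K V)] in
/-- Two distinct subspaces of dimension `s + 1` containing a subspace of dimension `s` meet in it,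
and span a subspace of dimension `s + 2`. -/
lemma inf_sup_of_points {p p' : Submodule K V} (hp : S ≤ p) (hp' : S ≤ p')
    (hd : finrank K p = finrank K S + 1) (hd' : finrank K p' = finrank K S + 1) (hne : p ≠ p') :
    p ⊓ p' = S ∧ finrank K ↥(p ⊔ p') = finrank K S + 2 := by
  have h1 := Submodule.finrank_sup_add_finrank_inf_eq p p'
  have h2 : S ≤ p ⊓ p' := le_inf hp hp'
  have h3 := Submodule.finrank_mono h2
  have h4 : finrank K ↥(p ⊓ p') < finrank K S + 1 := by
    by_contra! h
    have e1 := Submodule.eq_of_le_of_finrank_le (inf_le_left : p ⊓ p' ≤ p) (by omega)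
    have e2 := Submodule.eq_of_le_of_finrank_le (inf_le_right : p ⊓ p' ≤ p') (by omega)
    exact hne (e1.symm.trans e2)
  exact ⟨(Submodule.eq_of_le_of_finrank_le h2 (by omega)).symm, by omega⟩

lemma isPlane_between [Finite K] (hq : Nat.card K = q) (hST : S ≤ T)
    (hd : finrank K T = finrank K S + 3) : IsPlane (incidenceBetween S T) q where
  card_points := by
    rw [Fintype.card_subtype, card_atoms hq hST, ← qInt_three]; congr 1; omega
  card_lines := by
    rw [Fintype.card_subtype, card_coatoms hq hST, ← qInt_three]; congr 1; omega
  card_on l := by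
    have h := card_atoms hq l.2.1.1
    rw [show finrank K l.1 - finrank K S = 2 by have := l.2.2; omega, qInt_two] at h
    rw [← h]
    refine (card_filter_subtype _ (fun X => X ≤ l.1)).trans ?_
    congr 1
    ext X
    simp only [Finset.mem_filter_univ]
    have := l.2.1.2
    constructor
    · rintro ⟨⟨⟨h1, -⟩, h3⟩, h4⟩; exact ⟨⟨h1, h4⟩, h3⟩
    · rintro ⟨⟨h1, h4⟩, h3⟩; exact ⟨⟨⟨h1, h4.trans this⟩, h3⟩, h4⟩
  card_through p := by
    have h := card_coatoms hq p.2.1.2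
    rw [show finrank K T - finrank K p.1 = 2 by have := p.2.2; omega, qInt_two] at h
    rw [← h]
    refine (card_filter_subtype _ (fun X => p.1 ≤ X)).trans ?_
    congr 1
    ext X
    simp only [Finset.mem_filter_univ]
    have := p.2.1.1
    constructor
    · rintro ⟨⟨⟨-, h1⟩, h3⟩, h4⟩; exact ⟨⟨h4, h1⟩, h3⟩
    · rintro ⟨⟨h4, h1⟩, h3⟩; exact ⟨⟨⟨this.trans h4, h1⟩, h3⟩, h4⟩
  meet l l' hne := by
    have h1 := Submodule.finrank_sup_add_finrank_inf_eq l.1 l'.1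
    have h2 := Submodule.finrank_mono (sup_le l.2.1.2 l'.2.1.2)
    have h3 : finrank K l.1 < finrank K ↥(l.1 ⊔ l'.1) := by
      by_contra! h
      have e1 := Submodule.eq_of_le_of_finrank_le (le_sup_left : l.1 ≤ l.1 ⊔ l'.1) h
      have e2 := Submodule.eq_of_le_of_finrank_le (le_sup_right : l'.1 ≤ l.1 ⊔ l'.1)
        (by have := l.2.2; have := l'.2.2; omega)
      exact hne (Subtype.ext (e1.trans e2.symm))
    have h4 := l.2.2
    have h5 := l'.2.2
    exact ⟨⟨l.1 ⊓ l'.1, ⟨le_inf l.2.1.1 l'.2.1.1, inf_le_left.trans l.2.1.2⟩, by omega⟩,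
      inf_le_left, inf_le_right⟩
  join p p' hne := by
    have h := inf_sup_of_points p.2.1.1 p'.2.1.1 p.2.2 p'.2.2 (fun h => hne (Subtype.ext h))
    exact ⟨⟨p.1 ⊔ p'.1, ⟨p.2.1.1.trans le_sup_left, sup_le p.2.1.2 p'.2.1.2⟩, by omega⟩,
      le_sup_left, le_sup_right⟩
  unique p p' l l' h1 h2 h3 h4 := by
    by_contra! hne
    have h := inf_sup_of_points p.2.1.1 p'.2.1.1 p.2.2 p'.2.2 (fun h => hne.1 (Subtype.ext h))
    have h5 := l.2.2
    have h6 := l'.2.2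
    have e1 := Submodule.eq_of_le_of_finrank_le (sup_le h1 h2) (by omega)
    have e2 := Submodule.eq_of_le_of_finrank_le (sup_le h3 h4) (by omega)
    exact hne.2 (Subtype.ext (e1.symm.trans e2))

/-- The members of `F` among the points of an interval. -/
noncomputable def pointsOf (F : Set (Submodule K V)) (S T : Submodule K V) :
    Finset (PointsBetween S T) := {p | p.1 ∈ F}

/-- The members of `F` among the hyperplanes of an interval. -/
noncomputable def linesOf (F : Set (Submodule K V)) (S T : Submodule K V) :
    Finset (LinesBetween S T) := {l | l.1 ∈ F}

omit [FiniteDimensional K V] in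
@[simp] lemma mem_pointsOf {p : PointsBetween S T} : p ∈ pointsOf F S T ↔ p.1 ∈ F := by
  simp [pointsOf]

omit [FiniteDimensional K V] in
@[simp] lemma mem_linesOf {l : LinesBetween S T} : l ∈ linesOf F S T ↔ l.1 ∈ F := by
  simp [linesOf]

lemma isMatched_between (hF : IsForkFree F) :
    IsMatched (incidenceBetween S T) (pointsOf F S T) (linesOf F S T) where
  point p hp l hl l' hl' h1 h2 := Subtype.ext <| eq_of_comparable_of_finrank_eq
    (hF.up _ (mem_pointsOf.1 hp) _ (mem_linesOf.1 hl) _ (mem_linesOf.1 hl') h1 h2)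
    (by have := l.2.2; have := l'.2.2; omega)
  line l hl p hp p' hp' h1 h2 := Subtype.ext <| eq_of_comparable_of_finrank_eq
    (hF.down _ (mem_linesOf.1 hl) _ (mem_pointsOf.1 hp) _ (mem_pointsOf.1 hp') h1 h2)
    (p.2.2.trans p'.2.2.symm)

/-- The members of `F` of dimension `m` or `m + 1` between `S` and `T`. -/
noncomputable def middleBetween (F : Set (Submodule K V)) (m : ℕ) (S T : Submodule K V) :
    Finset (Submodule K V) :=
  {A | A ∈ F ∧ (finrank K A = m ∨ finrank K A = m + 1) ∧ S ≤ A ∧ A ≤ T}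

omit [FiniteDimensional K V] in
lemma card_middleBetween {m : ℕ} (hS : finrank K S + 1 = m) (hT : finrank K T = m + 2) :
    #(middleBetween F m S T) = #(pointsOf F S T) + #(linesOf F S T) := by
  have h1 : #(pointsOf F S T) = #{X : Submodule K V |
      ((S ≤ X ∧ X ≤ T) ∧ finrank K X = finrank K S + 1) ∧ X ∈ F} :=
    card_filter_subtype _ (fun X => X ∈ F)
  have h2 : #(linesOf F S T) = #{X : Submodule K V |
      ((S ≤ X ∧ X ≤ T) ∧ finrank K X + 1 = finrank K T) ∧ X ∈ F} :=
    card_filter_subtype _ (fun X => X ∈ F)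
  rw [h1, h2, ← Finset.card_union_of_disjoint]
  · congr 1
    ext A
    simp only [middleBetween, Finset.mem_union, Finset.mem_filter_univ, hS, hT]
    have : finrank K A + 1 = m + 2 ↔ finrank K A = m + 1 := by omega
    rw [this]
    tauto
  · rw [Finset.disjoint_filter]
    intro A _ h1 h2
    have := h1.1.2
    have := h2.1.2
    omega

lemma between_trichotomy [Finite K] (hq : Nat.card K = q) (hF : IsForkFree F) {m : ℕ}
    (hST : S ≤ T) (hS : finrank K S + 1 = m) (hT : finrank K T = m + 2) :
    #(middleBetween F m S T) ≤ q ^ 2 + q + 1 ∧ (#(middleBetween F m S T) = q ^ 2 + q + 1 →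
      pointsOf F S T = univ ∨ pointsOf F S T = ∅ ∨
        (q = 2 ∧ IsMixed (incidenceBetween S T) (pointsOf F S T) (linesOf F S T))) := by
  rw [card_middleBetween hS hT]
  have h := (isPlane_between hq hST (by omega)).trichotomy (isMatched_between hF)
    (two_le_of_natCard_eq hq)
  exact ⟨h.1, fun h' => (h.2 h').imp (fun h => h.1) (Or.imp_left fun h => h.1)⟩

variable [Fintype (V ≃ₗ[K] V)] {E : ℕ → Submodule K V} {m : ℕ}

/-- The interval has q² + q + 1 elements of dimension dim A, and each is carried to A by the same
number of automorphisms. -/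
lemma card_between_const [Finite K] (hq : Nat.card K = q) (hST : S ≤ T)
    (hS : finrank K S + 1 = m) (hT : finrank K T = m + 2) {A : Submodule K V}
    (hA : finrank K A = m ∨ finrank K A = m + 1) :
    #{g : V ≃ₗ[K] V | S.map (g : V →ₗ[K] V) ≤ A ∧ A ≤ T.map (g : V →ₗ[K] V)} *
      (level K V (finrank K A)).ncard = (q ^ 2 + q + 1) * Fintype.card (V ≃ₗ[K] V) := by
  have h1 : #{X : Submodule K V | (S ≤ X ∧ X ≤ T) ∧ finrank K X = finrank K A}
      = q ^ 2 + q + 1 := by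
    have h2 : finrank K T - finrank K S = 3 := by omega
    rcases hA with hA | hA
    · have := card_atoms hq hST
      rwa [h2, qInt_three, hS, ← hA] at this
    · have := card_coatoms hq hST
      rw [h2, qInt_three, hT] at this
      rw [← this, hA]
      congr 1
      ext X
      simp only [Finset.mem_filter_univ]
      have : finrank K X + 1 = m + 2 ↔ finrank K X = m + 1 := by omega
      rw [this]
  have h2 : #{g : V ≃ₗ[K] V | S.map (g : V →ₗ[K] V) ≤ A ∧ A ≤ T.map (g : V →ₗ[K] V)} =
      ∑ X : Submodule K V with (S ≤ X ∧ X ≤ T) ∧ finrank K X = finrank K A,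
        #{g : V ≃ₗ[K] V | X.map (g : V →ₗ[K] V) = A} := by
    rw [Finset.card_eq_sum_card_fiberwise (f := fun g : V ≃ₗ[K] V => A.comap (g : V →ₗ[K] V))
      (t := {X : Submodule K V | (S ≤ X ∧ X ≤ T) ∧ finrank K X = finrank K A})]
    · refine Finset.sum_congr rfl fun X hX => ?_
      rw [Finset.mem_filter_univ] at hX
      rw [Finset.filter_filter]
      congr 1
      ext g
      simp only [Finset.mem_filter_univ]
      constructor
      · rintro ⟨-, rfl⟩
        exact Submodule.map_comap_eq_of_surjective g.surjective A
      · rintro rfl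
        exact ⟨⟨(map_equiv_le_iff g).2 hX.1.1, (map_equiv_le_iff g).2 hX.1.2⟩,
          Submodule.comap_map_eq_of_injective g.injective X⟩
    · intro g hg
      simp only [Finset.coe_filter, Finset.mem_univ, true_and, Set.mem_ofPred_eq] at hg ⊢
      have h3 : (A.comap (g : V →ₗ[K] V)).map (g : V →ₗ[K] V) = A :=
        Submodule.map_comap_eq_of_surjective g.surjective A
      refine ⟨⟨?_, ?_⟩, ?_⟩
      · rw [← map_equiv_le_iff g, h3]; exact hg.1
      · rw [← map_equiv_le_iff g, h3]; exact hg.2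
      · rw [← finrank_map_equiv g, h3]
  rw [h2, Finset.sum_mul, ← h1, ← smul_eq_mul, ← Finset.sum_const]
  refine Finset.sum_congr rfl fun X hX => ?_
  rw [Finset.mem_filter_univ] at hX
  exact card_map_eq_mul hX.2

/-- The flag passes through A, so A lies below or above the whole interval. The middle members in it
then form a chain with dimensions in {m, m + 1}. -/
lemma card_middleBetween_le_two (hF : IsForkFree F) (hE : IsFullFlag E (2 * m + 1))
    {A : Submodule K V} (hA : A ∈ F) (hAm : finrank K A ≠ m ∧ finrank K A ≠ m + 1)
    {g : V ≃ₗ[K] V} (hg : g ∈ flagEvent F E (2 * m + 1) A) :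
    #(middleBetween F m ((E (m - 1)).map (g : V →ₗ[K] V)) ((E (m + 2)).map (g : V →ₗ[K] V)))
      ≤ 2 := by
  rw [flagEvent, Finset.mem_filter_univ] at hg
  have h1 : ∀ B ∈ middleBetween F m ((E (m - 1)).map (g : V →ₗ[K] V))
      ((E (m + 2)).map (g : V →ₗ[K] V)), ∀ C ∈ middleBetween F m
      ((E (m - 1)).map (g : V →ₗ[K] V)) ((E (m + 2)).map (g : V →ₗ[K] V)), B ≤ C ∨ C ≤ B := by
    intro B hB C hC
    simp only [middleBetween, Finset.mem_filter_univ] at hB hC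
    by_cases h : finrank K A < m
    · have h2 : A ≤ (E (m - 1)).map (g : V →ₗ[K] V) := by
        conv_lhs => rw [← hg.1]
        exact Submodule.map_mono (hE.mono (by omega))
      exact hF.up A hA B hB.1 C hC.1 (h2.trans hB.2.2.1) (h2.trans hC.2.2.1)
    · have h2 : (E (m + 2)).map (g : V →ₗ[K] V) ≤ A := by
        conv_rhs => rw [← hg.1]
        exact Submodule.map_mono (hE.mono (by omega))
      exact hF.down A hA B hB.1 C hC.1 (hB.2.2.2.trans h2) (hC.2.2.2.trans h2)
  refine (Finset.card_le_card_of_injOn (t := {m, m + 1})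
    (fun B : Submodule K V => finrank K B) ?_ ?_).trans
    Finset.card_le_two
  · intro B hB
    simp only [Finset.mem_coe, middleBetween, Finset.mem_filter_univ] at hB
    simpa using hB.2.1
  · intro B hB C hC h
    exact eq_of_comparable_of_finrank_eq (h1 B hB C hC) h

lemma odd_case [Finite K] (hq : Nat.card K = q) (hn : finrank K V = 2 * m + 1) (hm : 1 ≤ m)
    (hF : IsForkFree F) (hbot : ⊥ ∉ F) (htop : ⊤ ∉ F) :
    F.ncard ≤ (level K V m).ncard ∧ (F.ncard = (level K V m).ncard →
      (∀ A ∈ F, finrank K A = m ∨ finrank K A = m + 1) ∧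
      ∀ S T : Submodule K V, S ≤ T → finrank K S + 1 = m → finrank K T = m + 2 →
        #(middleBetween F m S T) = q ^ 2 + q + 1) := by
  obtain ⟨E, hE⟩ := exists_isFullFlag hn
  set γ := Fintype.card (V ≃ₗ[K] V) with hγ
  have hγ0 : 0 < γ := Fintype.card_pos
  set M := (level K V m).ncard with hM
  have hM' : (level K V (m + 1)).ncard = M :=
    le_antisymm (ncard_level_anti hq hn (by omega) (by omega))
      (ncard_level_mono hq hn (by omega) (by omega))
  have hq2 := two_le_of_natCard_eq hq
  set N := q ^ 2 + q + 1 with hN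
  have hN7 : 7 ≤ N := by nlinarith
  set mid : Finset (Submodule K V) :=
    {A | A ∈ F ∧ (finrank K A = m ∨ finrank K A = m + 1)} with hmid
  set far : Finset (Submodule K V) :=
    {A | A ∈ F ∧ ¬ (finrank K A = m ∨ finrank K A = m + 1)} with hfar
  have hcard : F.ncard = #mid + #far := by
    rw [ncard_eq_card_filter, ← Finset.card_filter_add_card_filter_not
      (fun A : Submodule K V => finrank K A = m ∨ finrank K A = m + 1), Finset.filter_filter,
      Finset.filter_filter]
  set U := far.biUnion (flagEvent F E (2 * m + 1)) with hU
  -- The events are disjoint. A far member has dimension at distance at least 3/2 from n/2, so each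
  -- has probability at least 2/M.
  have hUM : 2 * γ * #far ≤ #U * M := by
    rw [hU, Finset.card_biUnion, Finset.sum_mul, mul_comm, ← smul_eq_mul, ← Finset.sum_const]
    · refine Finset.sum_le_sum fun A hA => ?_
      rw [hfar, Finset.mem_filter_univ] at hA
      have h2 : 1 ≤ finrank K A := finrank_pos_of_ne_bot fun h => hbot (h ▸ hA.1)
      have h3 : finrank K A < 2 * m + 1 := hn ▸ Submodule.finrank_lt fun h => htop (h ▸ hA.1)
      have := (lt_card_flagEvent hq hn hE hF hA.1 h2 h3 (by omega)).2 (by omega)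
      rwa [show (2 * m + 1) / 2 = m by omega] at this
    · intro A hA B hB hAB
      rw [hfar, Finset.mem_coe, Finset.mem_filter_univ] at hA hB
      exact disjoint_flagEvent hn hA.1 hB.1 hAB
  set w : (V ≃ₗ[K] V) → ℕ := fun g => #(middleBetween F m ((E (m - 1)).map (g : V →ₗ[K] V))
    ((E (m + 2)).map (g : V →ₗ[K] V))) with hw
  have hS : finrank K (E (m - 1)) + 1 = m := by rw [hE.finrank_eq _ (by omega)]; omega
  have hT : finrank K (E (m + 2)) = m + 2 := hE.finrank_eq _ (by omega)
  have hST : E (m - 1) ≤ E (m + 2) := hE.mono (by omega)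
  have hsum : (∑ g, w g) * M = #mid * (N * γ) := by
    have h1 : ∑ g, w g = ∑ A ∈ mid, #{g : V ≃ₗ[K] V |
        (E (m - 1)).map (g : V →ₗ[K] V) ≤ A ∧ A ≤ (E (m + 2)).map (g : V →ₗ[K] V)} := by
      refine (Finset.sum_congr rfl fun g _ => ?_).trans
        (Finset.sum_card_bipartiteAbove_eq_sum_card_bipartiteBelow
          (fun (g : V ≃ₗ[K] V) (A : Submodule K V) =>
            (E (m - 1)).map (g : V →ₗ[K] V) ≤ A ∧ A ≤ (E (m + 2)).map (g : V →ₗ[K] V))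
          (s := univ) (t := mid))
      rw [hw, Finset.bipartiteAbove, hmid, Finset.filter_filter]
      simp only [middleBetween, and_assoc]
    rw [h1, Finset.sum_mul, ← smul_eq_mul, ← Finset.sum_const]
    refine Finset.sum_congr rfl fun A hA => ?_
    rw [hmid, Finset.mem_filter_univ] at hA
    have h2 := card_between_const hq hST hS hT hA.2
    have h3 : (level K V (finrank K A)).ncard = M := by
      rcases hA.2 with h | h
      · rw [h]
      · rw [h, hM']
    rwa [h3] at h2
  have hwN : ∀ g, w g ≤ N := fun g => (between_trichotomy hq hF (Submodule.map_mono hST)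
    (by rw [finrank_map_equiv, hS]) (by rw [finrank_map_equiv, hT])).1
  -- Each automorphism in a far event loses at least N - 2 against the plane bound N; this loss pays
  -- for the far members.
  have hwU : ∀ g, w g + (if g ∈ U then N - 2 else 0) ≤ N := by
    intro g
    split_ifs with hg
    · rw [hU, Finset.mem_biUnion] at hg
      obtain ⟨A, hA, hgA⟩ := hg
      rw [hfar, Finset.mem_filter_univ] at hA
      have : w g ≤ 2 := card_middleBetween_le_two hF hE hA.1 (not_or.1 hA.2) hgA
      omega
    · exact hwN g
  have htot : ∑ g, w g + #U * (N - 2) ≤ γ * N := by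
    have := Finset.sum_le_sum fun g (_ : g ∈ univ) => hwU g
    rw [Finset.sum_add_distrib, Finset.sum_ite_mem, Finset.univ_inter] at this
    simpa using this
  have hmain : #mid * N + 2 * (N - 2) * #far ≤ N * M := by
    refine Nat.le_of_mul_le_mul_right ?_ hγ0
    calc (#mid * N + 2 * (N - 2) * #far) * γ = #mid * (N * γ) + 2 * γ * #far * (N - 2) := by ring
      _ ≤ (∑ g, w g) * M + #U * M * (N - 2) := by
        rw [hsum]; exact Nat.add_le_add_left (Nat.mul_le_mul_right _ hUM) _
      _ = (∑ g, w g + #U * (N - 2)) * M := by ring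
      _ ≤ γ * N * M := Nat.mul_le_mul_right _ htot
      _ = _ := by ring
  have hgap : N * F.ncard + #far ≤ N * M := by
    refine le_trans ?_ hmain
    rw [hcard]
    -- The factor 2 in the far events matters here: it gives each far member weight at least N + 1
    -- rather than N - 2, so equality forces `far` to be empty.
    have : (N + 1) * #far ≤ 2 * (N - 2) * #far := Nat.mul_le_mul_right _ (by omega)
    linarith
  refine ⟨Nat.le_of_mul_le_mul_left (by omega) (show 0 < N by omega), fun heq => ?_⟩
  have hfar0 : #far = 0 := by rw [heq] at hgap; omega
  refine ⟨fun A hA => ?_, fun S T hST' hS' hT' => ?_⟩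
  · by_contra h
    rw [Finset.card_eq_zero] at hfar0
    have : A ∈ far := by rw [hfar, Finset.mem_filter_univ]; exact ⟨hA, h⟩
    rw [hfar0] at this
    exact absurd this (Finset.notMem_empty A)
  -- Every such interval is an image of the fixed one, so equality in the average gives equality in
  -- each.
  · obtain ⟨g, rfl, rfl⟩ := Submodule.exists_map_equiv_eq_pair (A := E (m - 1)) (B := E (m + 2))
      hST hST' (by omega) (by omega)
    rw [hfar0, add_zero] at hcard
    rw [← hcard, heq] at hsum
    have hM0 : 0 < M := by
      by_contra h0
      have : (level K V m) = ∅ := by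
        rw [← Set.ncard_eq_zero]; omega
      have h1 : E m ∈ level K V m := hE.finrank_eq _ (by omega)
      rw [this] at h1
      exact h1
    have h2 : ∑ g, w g = ∑ g : V ≃ₗ[K] V, N := by
      rw [Finset.sum_const, smul_eq_mul, Finset.card_univ]
      refine Nat.eq_of_mul_eq_mul_right hM0 ?_
      rw [hsum]; ring
    exact (Finset.sum_eq_sum_iff_of_le fun g _ => hwN g).1 h2 g (Finset.mem_univ g)

end Odd

/-! ### Gluing the planes: mixed planes excluded, homogeneous planes propagated. -/

section Connected

open scoped Classical

variable {K V : Type*} [Field K] [AddCommGroup V] [Module K V] [FiniteDimensional K V]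
  [Finite K] {q m : ℕ} {F : Set (Submodule K V)} {S T : Submodule K V}

lemma exists_atom_between {A B : Submodule K V} (h : A < B) :
    ∃ X, A ≤ X ∧ X ≤ B ∧ finrank K X = finrank K A + 1 := by
  have := finite_submodule K V
  have := Fintype.ofFinite (Submodule K V)
  have h1 := card_atoms rfl h.le
  have h2 := qInt_pos (Nat.card K) (Nat.sub_pos_of_lt (Submodule.finrank_lt_finrank_of_lt h))
  obtain ⟨X, hX⟩ := Finset.card_pos.1 (h1 ▸ h2)
  rw [Finset.mem_filter_univ] at hX
  exact ⟨X, hX.1.1, hX.1.2, hX.2⟩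

lemma exists_coatom_between {A B : Submodule K V} (h : A < B) :
    ∃ X, A ≤ X ∧ X ≤ B ∧ finrank K X + 1 = finrank K B := by
  have := finite_submodule K V
  have := Fintype.ofFinite (Submodule K V)
  have h1 := card_coatoms rfl h.le
  have h2 := qInt_pos (Nat.card K) (Nat.sub_pos_of_lt (Submodule.finrank_lt_finrank_of_lt h))
  obtain ⟨X, hX⟩ := Finset.card_pos.1 (h1 ▸ h2)
  rw [Finset.mem_filter_univ] at hX
  exact ⟨X, hX.1.1, hX.1.2, hX.2⟩

variable [Fintype (Submodule K V)]

/-- Take a line l of the plane with points p, p' in F and r not in F. Every plane [S, U] with U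
above l sees the same three points, so it is mixed too and contains a line of F through p or p'.
Since m ≥ 2 there are at least three such U, which is too many. -/
lemma not_isMixed_between (hq : Nat.card K = 2) (hn : finrank K V = 2 * m + 1) (hm : 2 ≤ m)
    (hF : IsForkFree F)
    (hall : ∀ S T : Submodule K V, S ≤ T → finrank K S + 1 = m → finrank K T = m + 2 →
      #(middleBetween F m S T) = 2 ^ 2 + 2 + 1)
    (hS : finrank K S + 1 = m) (hT : finrank K T = m + 2) :
    ¬ IsMixed (incidenceBetween S T) (pointsOf F S T) (linesOf F S T) := by
  intro h
  obtain ⟨l, p, p', r, hp, hp', hne, hr, hpl, hpl', hrl⟩ := h.exists_line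
  have hlF : l.1 ∉ F := fun hl => hne (h.isMatched.line l (mem_linesOf.2 hl) p hp p' hp' hpl hpl')
  rw [mem_pointsOf] at hp hp' hr
  have hl : finrank K l.1 = m + 1 := by have := l.2.2; omega
  have key : ∀ U : Submodule K V, l.1 ≤ U → finrank K U = m + 2 →
      ∃ f ∈ F, finrank K f = m + 1 ∧ f ≤ U ∧ (p.1 ≤ f ∨ p'.1 ≤ f) := by
    intro U hlU hU
    have hSU : S ≤ U := l.2.1.1.trans hlU
    rcases (between_trichotomy hq hF hSU hS hU).2 (hall S U hSU hS hU) with h1 | h1 | ⟨-, h1⟩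
    · have : (⟨r.1, ⟨r.2.1.1, hrl.trans hlU⟩, r.2.2⟩ : PointsBetween S U) ∈ pointsOf F S U := by
        rw [h1]; exact Finset.mem_univ _
      exact absurd (mem_pointsOf.1 this) hr
    · have : (⟨p.1, ⟨p.2.1.1, hpl.trans hlU⟩, p.2.2⟩ : PointsBetween S U) ∈ pointsOf F S U :=
        mem_pointsOf.2 hp
      rw [h1] at this
      exact absurd this (Finset.notMem_empty _)
    · obtain ⟨f, hf, hpf⟩ := h1.matched_or_matched
        (p := ⟨p.1, ⟨p.2.1.1, hpl.trans hlU⟩, p.2.2⟩)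
        (p' := ⟨p'.1, ⟨p'.2.1.1, hpl'.trans hlU⟩, p'.2.2⟩) (mem_pointsOf.2 hp)
        (mem_pointsOf.2 hp') (fun e => hne (Subtype.ext (Subtype.mk.inj e)))
      exact ⟨f.1, mem_linesOf.1 hf, by have := f.2.2; omega, f.2.1.2, hpf⟩
  choose! f hfF hfd hfU hpf using key
  have hcard := card_atoms hq (le_top : l.1 ≤ ⊤)
  rw [finrank_top, hn, hl] at hcard
  have h3 : 3 ≤ qInt 2 (2 * m + 1 - (m + 1)) := by
    have := qInt_mono 2 (show 2 ≤ 2 * m + 1 - (m + 1) by omega)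
    rwa [qInt_two] at this
  -- Two of the three U have chosen lines through the same one of p, p'. These lines coincide
  -- because F is fork-free, so they lie in U₁ ⊓ U₂ = l and equal l, which is not in F.
  obtain ⟨U₁, hU₁, U₂, hU₂, hU, hcol⟩ := Finset.exists_ne_map_eq_of_card_lt_of_maps_to
    (s := {X : Submodule K V | (l.1 ≤ X ∧ X ≤ ⊤) ∧ finrank K X = m + 1 + 1})
    (t := (Finset.univ : Finset Bool)) (f := fun U => decide (p.1 ≤ f U))
    (by rw [hcard, Finset.card_univ, Fintype.card_bool]; exact h3) (fun _ _ => Finset.mem_univ _)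
  rw [Finset.mem_filter_univ] at hU₁ hU₂
  have e : f U₁ = f U₂ := by
    refine eq_of_comparable_of_finrank_eq ?_
      ((hfd U₁ hU₁.1.1 hU₁.2).trans (hfd U₂ hU₂.1.1 hU₂.2).symm)
    by_cases hp1 : p.1 ≤ f U₁
    · have hp2 : p.1 ≤ f U₂ := by simpa [hp1] using hcol
      exact hF.up _ hp _ (hfF U₁ hU₁.1.1 hU₁.2) _ (hfF U₂ hU₂.1.1 hU₂.2) hp1 hp2
    · have hp2 : ¬ p.1 ≤ f U₂ := by simpa [hp1] using hcol
      exact hF.up _ hp' _ (hfF U₁ hU₁.1.1 hU₁.2) _ (hfF U₂ hU₂.1.1 hU₂.2)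
        ((hpf U₁ hU₁.1.1 hU₁.2).resolve_left hp1) ((hpf U₂ hU₂.1.1 hU₂.2).resolve_left hp2)
  have h4 := (inf_sup_of_points hU₁.1.1 hU₂.1.1 (by omega) (by omega) hU).1
  have h5 : f U₁ ≤ l.1 := by
    rw [← h4]
    exact le_inf (hfU U₁ hU₁.1.1 hU₁.2) (e ▸ hfU U₂ hU₂.1.1 hU₂.2)
  have h6 := Submodule.eq_of_le_of_finrank_eq h5 ((hfd U₁ hU₁.1.1 hU₁.2).trans hl.symm)
  exact hlF (h6 ▸ hfF U₁ hU₁.1.1 hU₁.2)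

/-- A and B are points of a common plane [H, T]: A ⊔ B has dimension m + 1 < n, so some T of
dimension m + 2 contains it. -/
lemma mem_of_adjacent (hn : finrank K V = 2 * m + 1) (hm : 1 ≤ m)
    (hall : ∀ S T : Submodule K V, S ≤ T → finrank K S + 1 = m → finrank K T = m + 2 →
      pointsOf F S T = univ ∨ pointsOf F S T = ∅)
    {A B H : Submodule K V} (hA : A ∈ F) (hAm : finrank K A = m) (hBm : finrank K B = m)
    (hHA : H ≤ A) (hHB : H ≤ B) (hH : finrank K H + 1 = m) : B ∈ F := by
  by_cases hAB : A = B
  · exact hAB ▸ hA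
  have h1 := (inf_sup_of_points hHA hHB (by omega) (by omega) hAB).2
  have h2 : A ⊔ B < ⊤ := by
    rw [lt_top_iff_ne_top]
    intro h
    rw [h, finrank_top] at h1
    omega
  obtain ⟨T, hT, -, hTd⟩ := exists_atom_between h2
  have hHT : H ≤ T := hHA.trans (le_sup_left.trans hT)
  rcases hall H T hHT hH (by omega) with h | h
  · have : (⟨B, ⟨hHB, le_sup_right.trans hT⟩, by omega⟩ : PointsBetween H T) ∈ pointsOf F H T := by
      rw [h]; exact Finset.mem_univ _
    exact mem_pointsOf.1 this
  · have : (⟨A, ⟨hHA, le_sup_left.trans hT⟩, by omega⟩ : PointsBetween H T) ∈ pointsOf F H T :=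
      mem_pointsOf.2 hA
    rw [h] at this
    exact absurd this (Finset.notMem_empty _)

/-- Exchange step: with H a hyperplane of A containing A ⊓ B, and D ≤ B one dimension above A ⊓ B,
the space H ⊔ D is adjacent to A and meets B in a larger dimension. -/
lemma mem_of_mem (hn : finrank K V = 2 * m + 1) (hm : 1 ≤ m)
    (hall : ∀ S T : Submodule K V, S ≤ T → finrank K S + 1 = m → finrank K T = m + 2 →
      pointsOf F S T = univ ∨ pointsOf F S T = ∅) :
    ∀ (k : ℕ) {A B : Submodule K V}, A ∈ F → finrank K A = m → finrank K B = m →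
      m - finrank K ↥(A ⊓ B) ≤ k → B ∈ F := by
  intro k
  induction k with
  | zero =>
    intro A B hA hAm hBm hk
    have h1 := Submodule.eq_of_le_of_finrank_le (inf_le_left : A ⊓ B ≤ A) (by omega)
    have h2 := Submodule.eq_of_le_of_finrank_le (inf_le_right : A ⊓ B ≤ B) (by omega)
    rwa [← h2, h1]
  | succ k ih =>
    intro A B hA hAm hBm hk
    by_cases hAB : A ⊓ B = A
    · have := Submodule.eq_of_le_of_finrank_eq (inf_eq_left.1 hAB) (by omega)
      exact this ▸ hA
    have hlt : A ⊓ B < A := lt_of_le_of_ne inf_le_left hAB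
    have hlt' : A ⊓ B < B := by
      refine lt_of_le_of_ne inf_le_right fun h => hAB ?_
      have := Submodule.eq_of_le_of_finrank_eq (inf_eq_right.1 h) (by omega)
      rw [this, inf_idem]
    obtain ⟨H, hH, hHA, hHd⟩ := exists_coatom_between hlt
    obtain ⟨D, hD, hDB, hDd⟩ := exists_atom_between hlt'
    have hDA : ¬ D ≤ A := by
      intro h
      have := Submodule.finrank_mono (le_inf h hDB)
      omega
    have h1 : finrank K ↥(H ⊓ D) < finrank K D :=
      Submodule.finrank_lt_finrank_of_lt
        (lt_of_le_of_ne inf_le_right fun h => hDA ((inf_eq_right.1 h).trans hHA))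
    have h2 := Submodule.finrank_mono (le_inf hH hD)
    have h3 := Submodule.finrank_sup_add_finrank_inf_eq H D
    have hC : finrank K ↥(H ⊔ D) = m := by omega
    have hCF : H ⊔ D ∈ F := mem_of_adjacent hn hm hall hA hAm hC hHA le_sup_left (by omega)
    refine ih hCF hC hBm ?_
    have h4 := Submodule.finrank_mono (le_inf (le_sup_right : D ≤ H ⊔ D) hDB)
    omega

lemma eq_level_of_no_mixed (hq : Nat.card K = q) (hn : finrank K V = 2 * m + 1) (hm : 1 ≤ m)
    (hcard : F.ncard = (level K V m).ncard)
    (hmid : ∀ A ∈ F, finrank K A = m ∨ finrank K A = m + 1)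
    (hall : ∀ S T : Submodule K V, S ≤ T → finrank K S + 1 = m → finrank K T = m + 2 →
      pointsOf F S T = univ ∨ pointsOf F S T = ∅) :
    F = level K V m ∨ F = level K V (m + 1) := by
  by_cases h : ∃ A ∈ F, finrank K A = m
  · obtain ⟨A, hA, hAm⟩ := h
    left
    refine (Set.eq_of_subset_of_ncard_le (fun B hB => ?_) hcard.le).symm
    exact mem_of_mem hn hm hall m hA hAm hB (Nat.sub_le _ _)
  · right
    push Not at h
    refine Set.eq_of_subset_of_ncard_le (fun A hA => (hmid A hA).resolve_left (h A hA)) ?_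
    rw [hcard]
    exact ncard_level_anti hq hn (by omega) (by omega)

end Connected

/-! ### The exceptional families in the Fano plane. -/

section Triangle

open scoped Classical

variable {K V : Type*} [Field K] [AddCommGroup V] [Module K V] {F : Set (Submodule K V)}

lemma exists_opposite_index : ∀ i j : Fin 3, i ≠ j →
    ∃ k : Fin 3, (i = k + 1 ∧ j = k + 2) ∨ (i = k + 2 ∧ j = k + 1) := by decide

lemma fin_three_add_ne : ∀ k : Fin 3, k + 1 ≠ k ∧ k + 2 ≠ k ∧ k + 1 ≠ k + 2 := by decide

lemma fin_three_exists_ne : ∀ i j : Fin 3, ∃ k, k ≠ i ∧ k ≠ j := by decide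

/-- The side of a triangle opposite to one of its vertices. -/
def sideOf (v : Fin 3 → V) (k : Fin 3) : Submodule K V := Submodule.span K {v (k + 1), v (k + 2)}

lemma exists_span_pair_iff (v : Fin 3 → V) (W : Submodule K V) :
    (∃ i j : Fin 3, i ≠ j ∧ W = Submodule.span K {v i, v j}) ↔ ∃ k, W = sideOf v k := by
  constructor
  · rintro ⟨i, j, hij, rfl⟩
    obtain ⟨k, ⟨rfl, rfl⟩ | ⟨rfl, rfl⟩⟩ := exists_opposite_index i j hij
    · exact ⟨k, rfl⟩
    · exact ⟨k, by rw [sideOf, Set.pair_comm]⟩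
  · rintro ⟨k, rfl⟩
    exact ⟨k + 1, k + 2, (fin_three_add_ne k).2.2, rfl⟩

lemma vertex_le_sideOf (v : Fin 3 → V) {i k : Fin 3} (h : i ≠ k) :
    Submodule.span K {v i} ≤ sideOf v k := by
  refine Submodule.span_mono ?_
  have : i = k + 1 ∨ i = k + 2 := by revert i k; decide
  rcases this with rfl | rfl <;> simp

section Basis

variable (v : Basis (Fin 3) K V)

lemma finrank_vertex (i : Fin 3) : finrank K (Submodule.span K {v i}) = 1 :=
  finrank_span_singleton (v.ne_zero i)

lemma finrank_sideOf (k : Fin 3) : finrank K (sideOf (K := K) v k) = 2 := by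
  have h : LinearIndependent K ![v (k + 1), v (k + 2)] := by
    have := v.linearIndependent.comp ![k + 1, k + 2] (by
      intro a b; revert a b k; decide)
    convert this using 1
    ext i; fin_cases i <;> rfl
  have := finrank_span_eq_card h
  rwa [Matrix.range_cons, Matrix.range_cons, Matrix.range_empty, Set.union_empty,
    Set.singleton_union, Fintype.card_fin] at this

lemma vertex_injective : Function.Injective fun i => Submodule.span K {v i} := by
  intro i j h
  by_contra hij
  have h1 : v i ∈ Submodule.span K (v '' {j}) := by
    rw [Set.image_singleton, ← (show Submodule.span K {v i} = Submodule.span K {v j} from h)]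
    exact Submodule.mem_span_singleton_self _
  exact v.linearIndependent.notMem_span_image (s := {j}) (x := i) (by simpa using hij) h1

lemma sideOf_injective : Function.Injective fun k => sideOf (K := K) v k := by
  intro k k' h
  by_contra hk
  have h0 : sideOf (K := K) v k = sideOf v k' := h
  have h1 : ⊤ ≤ sideOf (K := K) v k := by
    rw [← v.span_eq, Submodule.span_le]
    rintro _ ⟨i, rfl⟩
    by_cases hik : i = k
    · rw [h0]
      exact vertex_le_sideOf v (hik ▸ hk) (Submodule.mem_span_singleton_self _)
    · exact vertex_le_sideOf v hik (Submodule.mem_span_singleton_self _)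
  have h2 := finrank_sideOf v k
  rw [top_le_iff.1 h1, finrank_top, finrank_eq_card_basis v, Fintype.card_fin] at h2
  omega

lemma planesOfBasisFamily_eq : planesOfBasisFamily v =
    Set.range (fun k => sideOf (K := K) v k) ∪
      (level K V 1 \ Set.range fun i => Submodule.span K {v i}) := by
  ext W
  simp only [planesOfBasisFamily, Set.mem_union, Set.mem_ofPred_eq, exists_span_pair_iff, level,
    Set.mem_range, Set.mem_sdiff, not_exists, eq_comm (a := W), ne_eq]

lemma linesOfBasisFamily_eq : linesOfBasisFamily v =
    Set.range (fun i => Submodule.span K {v i}) ∪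
      (level K V 2 \ Set.range fun k => sideOf (K := K) v k) := by
  ext W
  have := exists_span_pair_iff (K := K) v W
  simp only [linesOfBasisFamily, Set.mem_union, Set.mem_ofPred_eq, level,
    Set.mem_range, Set.mem_sdiff, eq_comm (b := W), ← this]
  simp only [not_exists, not_and, ne_eq, eq_comm (a := W)]

lemma ncard_range_union_diff {α : Type*} [Finite α] {f : Fin 3 → α} (hf : Function.Injective f)
    {g : Fin 3 → α} (hg : Function.Injective g) {s t : Set α} (hfs : Set.range f ⊆ s)
    (hgt : Set.range g ⊆ t) (hst : Disjoint s t) :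
    (Set.range f ∪ (t \ Set.range g)).ncard = t.ncard := by
  have h1 : (Set.range f).ncard = 3 := by
    rw [← Set.image_univ, Set.ncard_image_of_injective _ hf, Set.ncard_univ, Nat.card_fin]
  have h2 : (Set.range g).ncard = 3 := by
    rw [← Set.image_univ, Set.ncard_image_of_injective _ hg, Set.ncard_univ, Nat.card_fin]
  rw [Set.ncard_union_eq ((hst.mono_left hfs).mono_right Set.sdiff_subset), h1]
  have := Set.ncard_sdiff_add_ncard_of_subset hgt
  omega

lemma disjoint_level {i j : ℕ} (h : i ≠ j) : Disjoint (level K V i) (level K V j) := by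
  rw [Set.disjoint_left]
  intro W hi hj
  exact h (hi.symm.trans hj)

lemma range_vertex_subset : (Set.range fun i => Submodule.span K {v i}) ⊆ level K V 1 := by
  rintro _ ⟨i, rfl⟩
  exact finrank_vertex v i

lemma range_sideOf_subset : (Set.range fun k => sideOf (K := K) v k) ⊆ level K V 2 := by
  rintro _ ⟨i, rfl⟩
  exact finrank_sideOf v i

variable [FiniteDimensional K V]

lemma isForkFree_of_finrank (hF : ∀ A ∈ F, finrank K A = 1 ∨ finrank K A = 2)
    (hp : ∀ x ∈ F, ∀ y ∈ F, ∀ y' ∈ F, finrank K x = 1 → finrank K y = 2 → finrank K y' = 2 →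
      x ≤ y → x ≤ y' → y = y')
    (hl : ∀ y ∈ F, ∀ x ∈ F, ∀ x' ∈ F, finrank K y = 2 → finrank K x = 1 → finrank K x' = 1 →
      x ≤ y → x' ≤ y → x = x') : IsForkFree F where
  up A hA B hB C hC hAB hAC := by
    by_cases h1 : finrank K A = finrank K B
    · exact Or.inl (Submodule.eq_of_le_of_finrank_eq hAB h1 ▸ hAC)
    by_cases h2 : finrank K A = finrank K C
    · exact Or.inr (Submodule.eq_of_le_of_finrank_eq hAC h2 ▸ hAB)
    have h3 := Submodule.finrank_mono hAB
    have h4 := hF A hA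
    have h5 := hF B hB
    have h6 := hF C hC
    exact Or.inl (hp A hA B hB C hC (by omega) (by omega) (by omega) hAB hAC).le
  down A hA B hB C hC hBA hCA := by
    by_cases h1 : finrank K B = finrank K A
    · exact Or.inr (hCA.trans (Submodule.eq_of_le_of_finrank_eq hBA h1).ge)
    by_cases h2 : finrank K C = finrank K A
    · exact Or.inl (hBA.trans (Submodule.eq_of_le_of_finrank_eq hCA h2).ge)
    have h3 := Submodule.finrank_mono hBA
    have h4 := hF A hA
    have h5 := hF B hB
    have h6 := hF C hC
    exact Or.inl (hl A hA B hB C hC (by omega) (by omega) (by omega) hBA hCA).le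

lemma eq_of_card_eq_three {α : Type*} {s : Finset α} (hs : #s = 3) {a b x y : α} (ha : a ∈ s)
    (hb : b ∈ s) (hx : x ∈ s) (hy : y ∈ s) (hab : a ≠ b) (hxa : x ≠ a) (hxb : x ≠ b)
    (hya : y ≠ a) (hyb : y ≠ b) : x = y := by
  by_contra hxy
  have h : #{a, b, x, y} = 4 := by
    rw [Finset.card_insert_of_notMem, Finset.card_insert_of_notMem, Finset.card_pair hxy] <;>
      simp [hab, hxa.symm, hya.symm, hxb.symm, hyb.symm]
  have h2 : ({a, b, x, y} : Finset α) ⊆ s := by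
    intro z hz
    simp only [Finset.mem_insert, Finset.mem_singleton] at hz
    rcases hz with rfl | rfl | rfl | rfl <;> assumption
  have := Finset.card_le_card h2
  omega

variable [Finite K]

/-- Two sides meet only in a vertex, and vertices are excluded. For q = 2 a side has three points,
two of them vertices, so only one point of the family lies on it. -/
lemma isForkFree_planesOfBasisFamily (hq : Nat.card K = 2) :
    IsForkFree (planesOfBasisFamily v) := by
  have := finite_submodule K V
  have := Fintype.ofFinite (Submodule K V)
  rw [planesOfBasisFamily_eq]
  have hF : ∀ A ∈ Set.range (fun k => sideOf (K := K) v k) ∪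
      (level K V 1 \ Set.range fun i => Submodule.span K {v i}),
      (finrank K A = 1 ∧ ∀ i, A ≠ Submodule.span K {v i}) ∨
        (finrank K A = 2 ∧ ∃ k, A = sideOf v k) := by
    rintro A (⟨k, rfl⟩ | ⟨hA, hA'⟩)
    · exact Or.inr ⟨finrank_sideOf v k, k, rfl⟩
    · exact Or.inl ⟨hA, fun i h => hA' ⟨i, h.symm⟩⟩
  refine isForkFree_of_finrank (fun A hA => (hF A hA).imp And.left And.left) ?_ ?_
  · intro x hx y hy y' hy' hxd hyd hyd' hxy hxy'
    obtain ⟨-, hx⟩ := (hF x hx).resolve_right (by omega)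
    obtain ⟨-, k, rfl⟩ := (hF y hy).resolve_left (by omega)
    obtain ⟨-, k', rfl⟩ := (hF y' hy').resolve_left (by omega)
    by_contra hne
    have hk : k ≠ k' := fun h => hne (h ▸ rfl)
    obtain ⟨t, ht, ht'⟩ : ∃ t : Fin 3, t ≠ k ∧ t ≠ k' := fin_three_exists_ne k k'
    have h1 := (inf_sup_of_points (S := x) hxy hxy' (by omega) (by omega) hne).1
    have h2 := le_inf (vertex_le_sideOf (K := K) v ht) (vertex_le_sideOf (K := K) v ht')
    rw [h1] at h2
    exact hx t (Submodule.eq_of_le_of_finrank_eq h2 (by rw [finrank_vertex, hxd])).symm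
  · intro y hy x hx x' hx' hyd hxd hxd' hxy hxy'
    obtain ⟨-, hx⟩ := (hF x hx).resolve_right (by omega)
    obtain ⟨-, hx'⟩ := (hF x' hx').resolve_right (by omega)
    obtain ⟨-, k, rfl⟩ := (hF y hy).resolve_left (by omega)
    have hc := card_atoms hq (bot_le : ⊥ ≤ sideOf (K := K) v k)
    rw [finrank_bot, hyd, qInt_two] at hc
    obtain ⟨hk1, hk2, hk3⟩ := fin_three_add_ne k
    refine eq_of_card_eq_three hc (a := Submodule.span K {v (k + 1)})
      (b := Submodule.span K {v (k + 2)}) ?_ ?_ ?_ ?_ ((vertex_injective v).ne hk3) (hx _) (hx _)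
      (hx' _) (hx' _) <;> rw [Finset.mem_filter_univ]
    · exact ⟨⟨bot_le, vertex_le_sideOf v hk1⟩, finrank_vertex v _⟩
    · exact ⟨⟨bot_le, vertex_le_sideOf v hk2⟩, finrank_vertex v _⟩
    · exact ⟨⟨bot_le, hxy⟩, hxd⟩
    · exact ⟨⟨bot_le, hxy'⟩, hxd'⟩

/-- Dually, three planes pass through a vertex and two of them are sides; two vertices span a side,
which is excluded. -/
lemma isForkFree_linesOfBasisFamily (hq : Nat.card K = 2) :
    IsForkFree (linesOfBasisFamily v) := by
  have := finite_submodule K V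
  have := Fintype.ofFinite (Submodule K V)
  rw [linesOfBasisFamily_eq]
  have hn : finrank K V = 3 := by rw [finrank_eq_card_basis v, Fintype.card_fin]
  have hF : ∀ A ∈ Set.range (fun i => Submodule.span K {v i}) ∪
      (level K V 2 \ Set.range fun k => sideOf (K := K) v k),
      (finrank K A = 1 ∧ ∃ i, A = Submodule.span K {v i}) ∨
        (finrank K A = 2 ∧ ∀ k, A ≠ sideOf v k) := by
    rintro A (⟨k, rfl⟩ | ⟨hA, hA'⟩)
    · exact Or.inl ⟨finrank_vertex v k, k, rfl⟩
    · exact Or.inr ⟨hA, fun i h => hA' ⟨i, h.symm⟩⟩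
  refine isForkFree_of_finrank (fun A hA => (hF A hA).imp And.left And.left) ?_ ?_
  · intro x hx y hy y' hy' hxd hyd hyd' hxy hxy'
    obtain ⟨-, k, rfl⟩ := (hF x hx).resolve_right (by omega)
    obtain ⟨-, hy⟩ := (hF y hy).resolve_left (by omega)
    obtain ⟨-, hy'⟩ := (hF y' hy').resolve_left (by omega)
    have hc := card_atoms hq (le_top : Submodule.span K {v k} ≤ ⊤)
    rw [finrank_top, hxd, hn, qInt_two] at hc
    obtain ⟨hk1, hk2, hk3⟩ := fin_three_add_ne k
    refine eq_of_card_eq_three hc (a := sideOf v (k + 1)) (b := sideOf v (k + 2)) ?_ ?_ ?_ ?_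
      ((sideOf_injective v).ne hk3) (hy _) (hy _) (hy' _) (hy' _) <;> rw [Finset.mem_filter_univ]
    · exact ⟨⟨vertex_le_sideOf v hk1.symm, le_top⟩, finrank_sideOf v _⟩
    · exact ⟨⟨vertex_le_sideOf v hk2.symm, le_top⟩, finrank_sideOf v _⟩
    · exact ⟨⟨hxy, le_top⟩, hyd⟩
    · exact ⟨⟨hxy', le_top⟩, hyd'⟩
  · intro y hy x hx x' hx' hyd hxd hxd' hxy hxy'
    obtain ⟨-, i, rfl⟩ := (hF x hx).resolve_right (by omega)
    obtain ⟨-, j, rfl⟩ := (hF x' hx').resolve_right (by omega)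
    obtain ⟨-, hy⟩ := (hF y hy).resolve_left (by omega)
    by_contra hne
    have hij : i ≠ j := fun h => hne (h ▸ rfl)
    obtain ⟨k, hk, hk'⟩ := fin_three_exists_ne i j
    have h1 := (inf_sup_of_points (S := ⊥) bot_le bot_le (by rw [hxd, finrank_bot])
      (by rw [hxd', finrank_bot]) hne).2
    rw [finrank_bot] at h1
    have h2 := Submodule.eq_of_le_of_finrank_eq (sup_le hxy hxy') (by omega)
    have h3 := Submodule.eq_of_le_of_finrank_eq
      (sup_le (vertex_le_sideOf (K := K) v hk.symm) (vertex_le_sideOf v hk'.symm))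
      (by rw [h1, finrank_sideOf])
    exact hy k (h2.symm.trans h3)

/-- Three points and three lines of a projective plane such that each of the lines passes through
two of the points are the vertices and sides of a triangle. -/
lemma exists_basis_of_triangle [Fintype (Submodule K V)] (hn : finrank K V = 3)
    {A : Finset (PointsBetween (⊥ : Submodule K V) ⊤)}
    {B : Finset (LinesBetween (⊥ : Submodule K V) ⊤)} (hA : #A = 3) (hB : #B = 3)
    (hAB : ∀ l ∈ B, #{p ∈ A | p.1 ≤ l.1} = 2) :
    ∃ v : Basis (Fin 3) K V, (∀ p, p ∈ A ↔ p.1 ∈ Set.range fun i => Submodule.span K {v i}) ∧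
      ∀ l, l ∈ B ↔ l.1 ∈ Set.range fun k => sideOf (K := K) v k := by
  let e := (A.equivFinOfCardEq hA).symm
  have hv : ∀ i, ∃ x : V, Submodule.span K {x} = (e i).1.1 := by
    intro i
    have h1 : finrank K (e i).1.1 = 1 := by rw [(e i).1.2.2, finrank_bot]
    obtain ⟨x, -, hx⟩ := finrank_eq_one_iff'.1 h1
    refine ⟨x.1, le_antisymm ?_ fun y hy => ?_⟩
    · rw [Submodule.span_singleton_le_iff_mem]; exact x.2
    · obtain ⟨c, hc⟩ := hx ⟨y, hy⟩
      rw [Submodule.mem_span_singleton]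
      exact ⟨c, congrArg Subtype.val hc⟩
  choose v hv using hv
  have hvd : ∀ i, finrank K (Submodule.span K {v i}) = 1 := fun i => by
    rw [hv, (e i).1.2.2, finrank_bot]
  have hinj : Function.Injective fun i => Submodule.span K {v i} := by
    intro i j h
    simp only [hv] at h
    exact e.injective (Subtype.ext (Subtype.ext h))
  have hside : ∀ i j, i ≠ j →
      finrank K ↥(Submodule.span K {v i} ⊔ Submodule.span K {v j}) = 2 := by
    intro i j hij
    have := (inf_sup_of_points (S := ⊥) bot_le bot_le (by rw [hvd, finrank_bot])
      (by rw [hvd, finrank_bot]) (hinj.ne hij)).2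
    rwa [finrank_bot] at this
  have hBsub : B.map (Function.Embedding.subtype _) ⊆ univ.image fun k => sideOf (K := K) v k := by
    intro W hW
    obtain ⟨l, hl, rfl⟩ := Finset.mem_map.1 hW
    obtain ⟨p, hp, p', hp', hne⟩ := Finset.one_lt_card.1 (by rw [hAB l hl]; norm_num)
    rw [Finset.mem_filter] at hp hp'
    obtain ⟨i, hi⟩ := e.surjective ⟨p, hp.1⟩
    obtain ⟨j, hj⟩ := e.surjective ⟨p', hp'.1⟩
    have hij : i ≠ j := by
      rintro rfl
      exact hne (congrArg Subtype.val (hi.symm.trans hj))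
    have h1 : Submodule.span K {v i} ≤ l.1 := by rw [hv, hi]; exact hp.2
    have h2 : Submodule.span K {v j} ≤ l.1 := by rw [hv, hj]; exact hp'.2
    have h3 := Submodule.eq_of_le_of_finrank_eq (sup_le h1 h2) (by
      have h3 := l.2.2
      have h4 : finrank K (⊤ : Submodule K V) = 3 := by rw [finrank_top, hn]
      rw [hside i j hij]
      omega)
    obtain ⟨k, hk⟩ := (exists_span_pair_iff v l.1).1 ⟨i, j, hij, by
      rw [← h3, Submodule.span_insert]⟩
    exact Finset.mem_image.2 ⟨k, Finset.mem_univ _, hk.symm⟩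
  -- There are at most three sides and B has three lines, so the lines are exactly the sides and the
  -- sides are distinct; this last fact rules out collinear vertices.
  have hBeq := Finset.eq_of_subset_of_card_le hBsub (by
    rw [Finset.card_map, hB]
    exact Finset.card_image_le.trans (by simp))
  have hsinj : Function.Injective fun k => sideOf (K := K) v k := by
    have := Finset.card_image_iff.1
      (show #(univ.image fun k => sideOf (K := K) v k) = #(univ : Finset (Fin 3)) by
        rw [← hBeq, Finset.card_map, hB, Finset.card_univ, Fintype.card_fin])
    rwa [Finset.coe_univ, Set.injOn_univ] at this
  have hspan : ⊤ ≤ Submodule.span K (Set.range v) := by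
    have h1 : sideOf v 0 < Submodule.span K (Set.range v) := by
      refine lt_of_le_of_ne (Submodule.span_mono ?_) fun h => ?_
      · rintro _ (rfl | rfl) <;> exact Set.mem_range_self _
      · have h2 : sideOf (K := K) v 1 ≤ sideOf v 0 := by
          rw [h]
          refine Submodule.span_mono ?_
          rintro _ (rfl | rfl) <;> exact Set.mem_range_self _
        have hd : ∀ k, finrank K (sideOf (K := K) v k) = 2 := fun k => by
          rw [sideOf, Submodule.span_insert]
          exact hside _ _ (fin_three_add_ne k).2.2
        have h3 := Submodule.eq_of_le_of_finrank_eq h2 (by rw [hd, hd])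
        exact absurd (hsinj h3) (by decide)
    have h2 := Submodule.finrank_lt_finrank_of_lt h1
    have h3 : finrank K (sideOf (K := K) v 0) = 2 := by
      rw [sideOf, Submodule.span_insert]
      exact hside _ _ (by decide)
    exact (Submodule.eq_top_of_finrank_eq (le_antisymm (Submodule.finrank_le _) (by omega))).ge
  refine ⟨basisOfTopLeSpanOfCardEqFinrank v hspan (by rw [Fintype.card_fin, hn]), fun p => ?_,
    fun l => ?_⟩
  · rw [coe_basisOfTopLeSpanOfCardEqFinrank]
    constructor
    · intro hp
      obtain ⟨i, hi⟩ := e.surjective ⟨p, hp⟩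
      exact ⟨i, by simp only [hv, hi]⟩
    · rintro ⟨i, hi⟩
      simp only [hv] at hi
      exact Subtype.ext hi ▸ (e i).2
  · rw [coe_basisOfTopLeSpanOfCardEqFinrank]
    have : l ∈ B ↔ l.1 ∈ B.map (Function.Embedding.subtype _) := by
      constructor
      · intro h
        exact Finset.mem_map.2 ⟨l, h, rfl⟩
      · intro h
        obtain ⟨l', hl', e⟩ := Finset.mem_map.1 h
        exact Subtype.ext e ▸ hl'
    rw [this, hBeq]
    simp

end Basis

end Triangle

/-! ### Assembly of the bound and of the extremal families. -/

section Main

open scoped Classical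

variable {K V : Type*} [Field K] [AddCommGroup V] [Module K V] [FiniteDimensional K V]
  [Finite K] {q n m : ℕ} {F : Set (Submodule K V)}

lemma IsMixed.exists_compl_points {P L : Type*} [Fintype P] [Fintype L] {I : P → L → Prop}
    {X : Finset P} {Y : Finset L} (h : IsMixed I X Y) (hX : #X = 4) :
    ∃ A : Finset P, (∀ p, p ∈ A ↔ p ∉ X) ∧ #A = 3 ∧ ∀ l ∈ Y, #{p ∈ A | I p l} = 2 := by
  have hc := h.isPlane.card_compl X
  rw [hX] at hc
  exact ⟨Xᶜ, fun p => Finset.mem_compl, by omega, fun l hl => h.card_compl_on_eq_two hX hl⟩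

lemma IsMixed.exists_compl_lines {P L : Type*} [Fintype P] [Fintype L] {I : P → L → Prop}
    {X : Finset P} {Y : Finset L} (h : IsMixed I X Y) (hY : #Y = 4) :
    ∃ B : Finset L, (∀ l, l ∈ B ↔ l ∉ Y) ∧ #B = 3 ∧ ∀ l ∈ B, #{p ∈ X | I p l} = 2 := by
  have hc := h.isPlane.dual.card_compl Y
  rw [hY] at hc
  exact ⟨Yᶜ, fun p => Finset.mem_compl, by omega,
    fun l hl => h.dual.lineDegree_eq_two hY (Finset.mem_compl.1 hl)⟩

/-- The triangle consists of the three-element part of F and the three-element complement of the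
other part. If |X| = 3, the points of X are its vertices and the lines outside Y its sides; if |Y| =
3, the points outside X are its vertices and the lines of Y its sides. -/
lemma eq_basisFamily_of_isMixed [Fintype (Submodule K V)] (hn : finrank K V = 3)
    (hmid : ∀ A ∈ F, finrank K A = 1 ∨ finrank K A = 2)
    (h : IsMixed (incidenceBetween (⊥ : Submodule K V) ⊤) (pointsOf F ⊥ ⊤) (linesOf F ⊥ ⊤)) :
    ∃ v : Basis (Fin 3) K V, F = planesOfBasisFamily v ∨ F = linesOfBasisFamily v := by
  have hp : ∀ W : Submodule K V, finrank K W = 1 →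
      (⊥ ≤ W ∧ W ≤ ⊤) ∧ finrank K W = finrank K (⊥ : Submodule K V) + 1 := fun W hW =>
    ⟨⟨bot_le, le_top⟩, by rw [hW, finrank_bot]⟩
  have hl : ∀ W : Submodule K V, finrank K W = 2 →
      (⊥ ≤ W ∧ W ≤ ⊤) ∧ finrank K W + 1 = finrank K (⊤ : Submodule K V) := fun W hW =>
    ⟨⟨bot_le, le_top⟩, by rw [hW, finrank_top, hn]⟩
  rcases h.card_eq with ⟨hX, hY⟩ | ⟨hX, hY⟩
  · obtain ⟨B, hB, hBc, hXB⟩ := h.exists_compl_lines hY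
    obtain ⟨v, hv, hv'⟩ := exists_basis_of_triangle hn hX hBc hXB
    refine ⟨v, Or.inr ?_⟩
    rw [linesOfBasisFamily_eq]
    ext W
    constructor
    · intro hW
      rcases hmid W hW with hd | hd
      · exact Or.inl ((hv ⟨W, hp W hd⟩).1 (mem_pointsOf.2 hW))
      · refine Or.inr ⟨hd, fun hr => ?_⟩
        exact (hB _).1 ((hv' ⟨W, hl W hd⟩).2 hr) (mem_linesOf.2 hW)
    · rintro (hr | ⟨hd, hr⟩)
      · exact mem_pointsOf.1 ((hv ⟨W, hp W (range_vertex_subset v hr)⟩).2 hr)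
      · by_contra hW
        exact hr ((hv' ⟨W, hl W hd⟩).1 ((hB _).2 fun h => hW (mem_linesOf.1 h)))
  · obtain ⟨A, hA, hAc, hAY⟩ := h.exists_compl_points hX
    obtain ⟨v, hv, hv'⟩ := exists_basis_of_triangle hn hAc hY hAY
    refine ⟨v, Or.inl ?_⟩
    rw [planesOfBasisFamily_eq]
    ext W
    constructor
    · intro hW
      rcases hmid W hW with hd | hd
      · refine Or.inr ⟨hd, fun hr => ?_⟩
        exact (hA _).1 ((hv ⟨W, hp W hd⟩).2 hr) (mem_pointsOf.2 hW)
      · exact Or.inl ((hv' ⟨W, hl W hd⟩).1 (mem_linesOf.2 hW))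
    · rintro (hr | ⟨hd, hr⟩)
      · exact mem_linesOf.1 ((hv' ⟨W, hl W (range_sideOf_subset v hr)⟩).2 hr)
      · by_contra hW
        exact hr ((hv ⟨W, hp W hd⟩).1 ((hA _).2 fun h => hW (mem_pointsOf.1 h)))

lemma succ_le_qInt {q n : ℕ} (hq : 2 ≤ q) (hn : 2 ≤ n) :
    n + 1 ≤ qInt q n ∧ (¬ (n = 2 ∧ q = 2) → n + 1 < qInt q n) := by
  induction n, hn using Nat.le_induction with
  | base => rw [qInt_two]; omega
  | succ n hn ih =>
    rw [qInt_succ]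
    have : 2 * qInt q n ≤ q * qInt q n := Nat.mul_le_mul_right _ hq
    omega

/-- The level of dimension 1 already has [n] ≥ n + 1 elements, with equality only for n = q = 2;
this comparison with full chains is the source of that exception. -/
lemma succ_le_ncard_level (hq : Nat.card K = q) (hn : finrank K V = n) (hn2 : 2 ≤ n) :
    n + 1 ≤ (level K V (n / 2)).ncard ∧
      (¬ (n = 2 ∧ q = 2) → n + 1 < (level K V (n / 2)).ncard) := by
  have := finite_submodule K V
  have := Fintype.ofFinite (Submodule K V)
  have h1 := ncard_level_succ (V := V) hq hn 0
  rw [level_zero, Set.ncard_singleton, zero_add, Nat.sub_zero, one_mul,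
    show qInt q 1 = 1 by simp [qInt], mul_one] at h1
  have h2 := ncard_level_mono (V := V) hq hn (show 1 ≤ n / 2 by omega) (by omega)
  rw [h1] at h2
  have h3 := succ_le_qInt (two_le_of_natCard_eq hq) hn2
  exact ⟨h3.1.trans h2, fun h => (h3.2 h).trans_le h2⟩

lemma ncard_level_half (hq : Nat.card K = q) (hn : finrank K V = n) :
    (level K V ((n + 1) / 2)).ncard = (level K V (n / 2)).ncard :=
  le_antisymm (ncard_level_anti hq hn (by omega) (by omega))
    (ncard_level_mono hq hn (by omega) (by omega))

lemma odd_structure (hq : Nat.card K = q) (hn : finrank K V = 2 * m + 1) (hm : 1 ≤ m)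
    (hF : IsForkFree F) (hbot : ⊥ ∉ F) (htop : ⊤ ∉ F)
    (hcard : F.ncard = (level K V m).ncard) :
    F = level K V m ∨ F = level K V (m + 1) ∨ (m = 1 ∧ q = 2 ∧ ∃ v : Basis (Fin 3) K V,
      F = planesOfBasisFamily v ∨ F = linesOfBasisFamily v) := by
  have := finite_submodule K V
  have := Fintype.ofFinite (Submodule K V)
  have := Module.finite_of_finite K (M := V)
  have : Finite (V ≃ₗ[K] V) := Finite.of_injective _ DFunLike.coe_injective
  have := Fintype.ofFinite (V ≃ₗ[K] V)
  obtain ⟨hmid, hall⟩ := (odd_case hq hn hm hF hbot htop).2 hcard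
  by_cases hmix : ∃ S T : Submodule K V, S ≤ T ∧ finrank K S + 1 = m ∧ finrank K T = m + 2 ∧
      q = 2 ∧ IsMixed (incidenceBetween S T) (pointsOf F S T) (linesOf F S T)
  · obtain ⟨S, T, hST, hS, hT, rfl, hmix⟩ := hmix
    by_cases hm1 : m = 1
    · subst hm1
      obtain rfl : S = ⊥ := Submodule.finrank_eq_zero.1 (by omega)
      obtain rfl : T = ⊤ := Submodule.eq_top_of_finrank_eq (by omega)
      exact Or.inr (Or.inr ⟨rfl, rfl, eq_basisFamily_of_isMixed hn hmid hmix⟩)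
    · exact absurd hmix (not_isMixed_between hq hn (by omega) hF hall hS hT)
  · refine (eq_level_of_no_mixed hq hn hm hcard hmid fun S T hST hS hT => ?_).imp_right Or.inl
    rcases (between_trichotomy hq hF hST hS hT).2 (hall S T hST hS hT) with h | h | h
    · exact Or.inl h
    · exact Or.inr h
    · exact absurd ⟨S, T, hST, hS, hT, h⟩ hmix

theorem forkFree_extremal (hq : Nat.card K = q) (hn : finrank K V = n) (hn1 : n ≠ 1)
    (hF : IsForkFree F) :
    F.ncard ≤ (level K V (n / 2)).ncard ∧ (¬ (n = 2 ∧ q = 2) →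
      F.ncard = (level K V (n / 2)).ncard →
      F = level K V (n / 2) ∨ F = level K V ((n + 1) / 2) ∨
        (n = 3 ∧ q = 2 ∧ ∃ v : Basis (Fin 3) K V,
          F = planesOfBasisFamily v ∨ F = linesOfBasisFamily v)) := by
  have := finite_submodule K V
  have := Fintype.ofFinite (Submodule K V)
  have := Module.finite_of_finite K (M := V)
  have : Finite (V ≃ₗ[K] V) := Finite.of_injective _ DFunLike.coe_injective
  have := Fintype.ofFinite (V ≃ₗ[K] V)
  rcases Nat.eq_zero_or_pos n with rfl | hpos
  · have h : F ⊆ level K V (0 / 2) := fun A _ => by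
      have := A.finrank_le
      exact Nat.le_zero.1 (this.trans hn.le)
    exact ⟨Set.ncard_le_ncard h, fun _ h' => Or.inl (Set.eq_of_subset_of_ncard_le h h'.ge)⟩
  by_cases hbt : ⊥ ∈ F ∨ ⊤ ∈ F
  -- All members lie above ⊥, or all below ⊤, so F is a chain.
  · have h1 : F.ncard ≤ n + 1 := by
      rw [← hn]
      refine ncard_le_of_chain fun A hA B hB => ?_
      rcases hbt with h | h
      · exact hF.up _ h A hA B hB bot_le bot_le
      · exact hF.down _ h A hA B hB le_top le_top
    have h2 := succ_le_ncard_level (V := V) hq hn (by omega)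
    exact ⟨h1.trans h2.1, fun h h' => absurd h' (h1.trans_lt (h2.2 h)).ne⟩
  obtain ⟨hbot, htop⟩ := not_or.1 hbt
  rcases Nat.even_or_odd' n with ⟨m, rfl | rfl⟩
  · rw [Nat.mul_div_cancel_left _ two_pos]
    have h := even_case hq hn hF hbot htop
    exact ⟨h.1, fun _ h' => Or.inl (Set.eq_of_subset_of_ncard_le (h.2 h') h'.ge)⟩
  · rw [show (2 * m + 1) / 2 = m by omega, show (2 * m + 1 + 1) / 2 = m + 1 by omega]
    refine ⟨(odd_case hq hn (by omega) hF hbot htop).1, fun _ h' => ?_⟩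
    refine (odd_structure hq hn (by omega) hF hbot htop h').imp_right (Or.imp_right ?_)
    rintro ⟨rfl, h⟩
    exact ⟨rfl, h⟩

lemma ncard_planesOfBasisFamily (v : Basis (Fin 3) K V) :
    (planesOfBasisFamily v).ncard = (level K V 1).ncard := by
  have := finite_submodule K V
  rw [planesOfBasisFamily_eq]
  exact ncard_range_union_diff (sideOf_injective v) (vertex_injective v) (range_sideOf_subset v)
    (range_vertex_subset v) (disjoint_level (by norm_num))

lemma ncard_linesOfBasisFamily (v : Basis (Fin 3) K V) :
    (linesOfBasisFamily v).ncard = (level K V 2).ncard := by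
  have := finite_submodule K V
  rw [linesOfBasisFamily_eq]
  exact ncard_range_union_diff (vertex_injective v) (sideOf_injective v) (range_vertex_subset v)
    (range_sideOf_subset v) (disjoint_level (by norm_num))

lemma laStar_VLambda (hq : Nat.card K = q) (hn : finrank K V = n) (hn1 : n ≠ 1) :
    LaStar K V VLambda = (level K V (n / 2)).ncard := by
  have := Module.finite_of_finite K (M := V)
  have h := isGreatest_LaStar K V VLambda (by
    intro P hP
    simp only [VLambda, Set.mem_insert_iff, Set.mem_singleton_iff] at hP
    rcases hP with rfl | rfl
    · exact ⟨VPoset.x⟩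
    · exact ⟨OrderDual.toDual VPoset.x⟩)
  refine le_antisymm ?_ (h.2 ⟨_, (isInducedFree_VLambda_iff _).2 (isForkFree_level _), rfl⟩)
  obtain ⟨F, hF, hc⟩ := h.1
  rw [← hc]
  exact (forkFree_extremal hq hn hn1 ((isInducedFree_VLambda_iff _).1 hF)).1

end Main

theorem mainTheorem2 (K V : Type*) [Field K] [Finite K] [AddCommGroup V] [Module K V]
    [FiniteDimensional K V] (q n : ℕ) (hq : Nat.card K = q) (hn : Module.finrank K V = n)
    (hn1 : n ≠ 1) :
    (LaStar K V VLambda : ℚ) = gaussBinom q n (n / 2) ∧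
    (¬ (n = 2 ∧ q = 2) →
      ∀ F : Set (Submodule K V),
        (IsInducedFree VLambda F ∧ F.ncard = LaStar K V VLambda) ↔
          (F = level K V (n / 2) ∨ F = level K V ((n + 1) / 2) ∨
            (n = 3 ∧ q = 2 ∧ ∃ v : Module.Basis (Fin 3) K V,
              F = planesOfBasisFamily v ∨ F = linesOfBasisFamily v))) := by
  rw [laStar_VLambda hq hn hn1]
  refine ⟨ncard_level_eq_gaussBinom hq hn _, fun hnq F => ?_⟩
  rw [isInducedFree_VLambda_iff]
  constructor
  · rintro ⟨hF, hc⟩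
    exact (forkFree_extremal hq hn hn1 hF).2 hnq hc
  · rintro (rfl | rfl | ⟨rfl, rfl, v, rfl | rfl⟩)
    · exact ⟨isForkFree_level _, rfl⟩
    · exact ⟨isForkFree_level _, ncard_level_half hq hn⟩
    · exact ⟨isForkFree_planesOfBasisFamily v hq, ncard_planesOfBasisFamily v⟩
    · exact ⟨isForkFree_linesOfBasisFamily v hq,
        (ncard_linesOfBasisFamily v).trans (ncard_level_half hq hn)⟩
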